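/- **Theorem 4.2 (Cuntz inverse monoid).** All inverse semigroups have a zero and carry the natural partial order. An *inverse $\wedge$-semigroup* is one in which any two elements have a meet; elements $s,t$ are *compatible* if $s^{-1}t$ and $st^{-1}$ are idempotents. An inverse semigroup is *distributive* if all finite non-empty compatible subsets have joins and multiplication on either side distributes over these joins; it is *Boolean* if moreover its idempotents form a (not necessarily unital) Boolean algebra. For finite sets write $A\to B$ if for every $a\in A$ and every $0\ne x\le a$ there is $b\in B$ with $x\wedge b\neq 0$, and $A\leftrightarrow B$ if $A\to B$ and $B\to A$; a *finite cover* of $s$ is a finite set $A$ of elements below $s$ with $\{s\}\to A$. A homomorphism $\theta\colon S\to T$ to a distributive inverse semigroup is *cover-to-join* if $\theta(s)=\bigvee\theta(A)$ for every finite cover $A$ of every $s$. For an inverse $\wedge$-semigroup $S$ let $\mathbf S=S/{\leftrightarrow}$ and let the *distributive completion* $\mathsf D(S)$ be the inverse semigroup of finitely generated compatible order ideals of $\mathbf S$, modulo the congruence identifying two ideals when $\leftrightarrow$ holds between finite generating sets of them; let $\delta\colon S\to\mathsf D(S)$ send $s$ to the class of the principal order ideal generated by the class of $s$. $S$ is *pre-Boolean*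 if $\mathsf D(S)$ is Boolean. Let $n\ge 2$ and let $P_n=\langle a_1,\dots,a_n,a_1^{-1},\dots,a_n^{-1} : a_i^{-1}a_i=1,\ a_i^{-1}a_j=0\ (i\ne j)\rangle$ be the polycyclic monoid (a presentation of monoids with zero). Put $C_n=\mathsf D(P_n)$, the *Cuntz inverse monoid*. Then: 1. $P_n$ is an inverse $\wedge$-semigroup and is pre-Boolean. 2. $\delta\colon P_n\to C_n$ is the Boolean completion of $P_n$: $C_n$ is a Boolean inverse $\wedge$-semigroup, $\delta$ is a cover-to-join homomorphism with $\delta(s)=0$ only for $s=0$, and for every cover-to-join homomorphism $\theta\colon P_n\to T$ to a distributive inverse semigroup $T$ there is a unique homomorphism $\bar\theta\colon C_n\to T$ preserving the joins of finite compatible sets with $\bar\theta\delta=\theta$. 3. $C_n$ is congruence-free: it has exactly two congruences, equality and the universal one. 4. The group of units of the monoid $C_n$ is isomorphic to the Thompson group $G_{n,1}$. Here $G_{n,r}$ is the maximum group image of the inverse monoid of all isomorphisms between finitely generated essential subacts of the free right act on $r$ generators over the free monoid on $n$ letters, that is, its quotient identifying two isomorphisms that have a common restriction in the monoid (a subact is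 essential if it meets every non-empty subact). -/

import Mathlib

/-! ### Inverse semigroups with zero -/

/-- `S` is an inverse semigroup with zero: every `a` has a unique (generalized) inverse `a⁻¹`. -/
class InverseSemigroup (S : Type*) [SemigroupWithZero S] extends Inv S where
  mul_inv_mul : ∀ a : S, a * a⁻¹ * a = a
  inv_mul_inv : ∀ a : S, a⁻¹ * a * a⁻¹ = a⁻¹
  inv_unique : ∀ a b : S, a * b * a = a → b * a * b = b → b = a⁻¹

namespace InverseSemigroup

/-- Equational criterion for being an inverse semigroup. -/
abbrev ofEquational {S : Type*} [SemigroupWithZero S] [Inv S]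
    (h₁ : ∀ a : S, a * a⁻¹ * a = a) (h₂ : ∀ a : S, a⁻¹⁻¹ = a)
    (h₃ : ∀ a b : S, (a * b)⁻¹ = b⁻¹ * a⁻¹)
    (h₄ : ∀ a b : S, (a * a⁻¹) * (b * b⁻¹) = (b * b⁻¹) * (a * a⁻¹)) :
    InverseSemigroup S where
  mul_inv_mul := h₁
  inv_mul_inv a := by simpa [h₂] using h₁ a⁻¹
  inv_unique := by
    have h₁' : ∀ a : S, a⁻¹ * a * a⁻¹ = a⁻¹ := fun a => by simpa [h₂] using h₁ a⁻¹
    have key : ∀ e : S, e * e = e → e = e * e⁻¹ := by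
      intro e he
      have hc : (e⁻¹ * e) * (e * e⁻¹) = (e * e⁻¹) * (e⁻¹ * e) := by
        simpa [h₂] using h₄ e⁻¹ e
      have hi : e⁻¹ = (e⁻¹ * e) * (e * e⁻¹) := by
        calc e⁻¹ = e⁻¹ * (e * e) * e⁻¹ := by rw [he, h₁']
          _ = _ := by simp only [mul_assoc]
      have hie : e⁻¹ = e := by
        calc e⁻¹ = (e⁻¹ * e) * (e * e⁻¹) := hi
          _ = (e * e⁻¹) * (e⁻¹ * e) := hc
          _ = ((e⁻¹ * e) * (e * e⁻¹))⁻¹ := by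
              rw [hc]; simp only [h₃, h₂, hc]
          _ = e⁻¹⁻¹ := by rw [← hi]
          _ = e := h₂ e
      rw [hie, he]
    have comm : ∀ e f : S, e * e = e → f * f = f → e * f = f * e := by
      intro e f he hf
      rw [key e he, key f hf]; exact h₄ e f
    intro a b hab hba
    have e1 : (a * b) * (a * b) = a * b := by rw [← mul_assoc, hab]
    have e2 : (b * a) * (b * a) = b * a := by rw [← mul_assoc, hba]
    have e3 : (a * a⁻¹) * (a * a⁻¹) = a * a⁻¹ := by rw [← mul_assoc, h₁]
    have e4 : (a⁻¹ * a) * (a⁻¹ * a) = a⁻¹ * a := by rw [← mul_assoc, h₁']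
    calc b = b * a * b := hba.symm
      _ = b * (a * a⁻¹ * a) * b := by rw [h₁]
      _ = b * ((a * a⁻¹) * (a * b)) := by simp only [mul_assoc]
      _ = b * ((a * b) * (a * a⁻¹)) := by rw [comm _ _ e3 e1]
      _ = (b * a * b) * (a * a⁻¹) := by simp only [mul_assoc]
      _ = b * (a * a⁻¹) := by rw [hba]
      _ = b * ((a * a⁻¹ * a) * a⁻¹) := by rw [h₁]
      _ = (b * a) * (a⁻¹ * a) * a⁻¹ := by simp only [mul_assoc]
      _ = (a⁻¹ * a) * (b * a) * a⁻¹ := by rw [comm _ _ e2 e4]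
      _ = a⁻¹ * (a * b * a) * a⁻¹ := by simp only [mul_assoc]
      _ = a⁻¹ := by rw [hab, h₁']

section Basic

variable {S : Type*} [SemigroupWithZero S] [InverseSemigroup S]

theorem inv_inv' (a : S) : a⁻¹⁻¹ = a :=
  (inv_unique a⁻¹ a (inv_mul_inv a) (mul_inv_mul a)).symm

theorem inv_eq_self_of_idem {e : S} (he : e * e = e) : e⁻¹ = e :=
  (inv_unique e e (by rw [he, he]) (by rw [he, he])).symm

theorem mul_idem {e f : S} (he : e * e = e) (hf : f * f = f) : (e * f) * (e * f) = e * f := by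
  have a1 := mul_inv_mul (e * f)
  have a2 := inv_mul_inv (e * f)
  set x := (e * f)⁻¹ with hx
  have hfx : f * x * e = x := by
    refine inv_unique (e * f) (f * x * e) ?_ ?_
    · calc e * f * (f * x * e) * (e * f) = e * (f * f) * x * (e * e) * f := by
            simp only [mul_assoc]
        _ = e * f * x * (e * f) := by rw [he, hf]; simp only [mul_assoc]
        _ = e * f := a1
    · calc f * x * e * (e * f) * (f * x * e) = f * (x * ((e * e) * (f * f)) * x) * e := by
            simp only [mul_assoc]
        _ = f * x * e := by rw [he, hf, a2]
  have hxx : x * x = x := by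
    calc x * x = (f * x * e) * (f * x * e) := by rw [hfx]
      _ = f * (x * (e * f) * x) * e := by simp only [mul_assoc]
      _ = x := by rw [a2, hfx]
  have h3 : e * f = x := by
    rw [← inv_inv' (e * f), ← hx]; exact inv_eq_self_of_idem hxx
  rw [h3, hxx]

theorem idem_comm {e f : S} (he : e * e = e) (hf : f * f = f) : e * f = f * e := by
  have h1 := mul_idem he hf
  have h2 := mul_idem hf he
  have : f * e = (e * f)⁻¹ := by
    refine inv_unique (e * f) (f * e) ?_ ?_
    · calc e * f * (f * e) * (e * f) = e * (f * f) * (e * e) * f := by simp only [mul_assoc]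
        _ = (e * f) * (e * f) := by rw [he, hf]; simp only [mul_assoc]
        _ = e * f := h1
    · calc f * e * (e * f) * (f * e) = f * (e * e) * (f * f) * e := by simp only [mul_assoc]
        _ = (f * e) * (f * e) := by rw [he, hf]; simp only [mul_assoc]
        _ = f * e := h2
  rw [this, inv_eq_self_of_idem h1]

theorem idem_mul_inv (a : S) : (a * a⁻¹) * (a * a⁻¹) = a * a⁻¹ := by
  rw [← mul_assoc, mul_inv_mul]

theorem idem_inv_mul (a : S) : (a⁻¹ * a) * (a⁻¹ * a) = a⁻¹ * a := by
  rw [← mul_assoc, inv_mul_inv]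

theorem mul_inv_rev' (a b : S) : (a * b)⁻¹ = b⁻¹ * a⁻¹ := by
  have hc := idem_comm (idem_mul_inv b) (idem_inv_mul a)
  refine (inv_unique (a * b) (b⁻¹ * a⁻¹) ?_ ?_).symm
  · calc a * b * (b⁻¹ * a⁻¹) * (a * b) = a * ((b * b⁻¹) * (a⁻¹ * a)) * b := by
          simp only [mul_assoc]
      _ = (a * a⁻¹ * a) * (b * b⁻¹ * b) := by rw [hc]; simp only [mul_assoc]
      _ = a * b := by rw [mul_inv_mul, mul_inv_mul]
  · calc b⁻¹ * a⁻¹ * (a * b) * (b⁻¹ * a⁻¹) = b⁻¹ * ((a⁻¹ * a) * (b * b⁻¹)) * a⁻¹ := by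
          simp only [mul_assoc]
      _ = (b⁻¹ * b * b⁻¹) * (a⁻¹ * a * a⁻¹) := by rw [← hc]; simp only [mul_assoc]
      _ = b⁻¹ * a⁻¹ := by rw [inv_mul_inv, inv_mul_inv]

theorem conj_idem (a : S) {e : S} (he : e * e = e) :
    (a⁻¹ * e * a) * (a⁻¹ * e * a) = a⁻¹ * e * a := by
  calc (a⁻¹ * e * a) * (a⁻¹ * e * a) = a⁻¹ * (e * (a * a⁻¹)) * (e * a) := by
        simp only [mul_assoc]
    _ = (a⁻¹ * a * a⁻¹) * (e * e) * a := by
        rw [idem_comm he (idem_mul_inv a)]; simp only [mul_assoc]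
    _ = a⁻¹ * e * a := by rw [inv_mul_inv, he]

end Basic

end InverseSemigroup

/-! ### The natural partial order, meets, joins, compatibility -/

section Order

variable {S : Type*} [SemigroupWithZero S] [InverseSemigroup S]

/-- The natural partial order of an inverse semigroup. -/
def NatLE (a b : S) : Prop := a = b * (a⁻¹ * a)

/-- `m` is the meet of `a` and `b` for the natural partial order. -/
def IsMeetOf (m a b : S) : Prop :=
  NatLE m a ∧ NatLE m b ∧ ∀ c, NatLE c a → NatLE c b → NatLE c m

/-- `j` is the join (least upper bound) of `X` for the natural partial order.
For `X = ∅` this says `j = 0`. -/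
def IsJoinOf (j : S) (X : Set S) : Prop :=
  (∀ x ∈ X, NatLE x j) ∧ ∀ c, (∀ x ∈ X, NatLE x c) → NatLE j c

/-- Two elements are compatible if `s⁻¹ t` and `s t⁻¹` are idempotents. -/
def Compatible (s t : S) : Prop := IsIdempotentElem (s⁻¹ * t) ∧ IsIdempotentElem (s * t⁻¹)

/-- A set of pairwise compatible elements. -/
def CompatibleSet (X : Set S) : Prop := ∀ s ∈ X, ∀ t ∈ X, Compatible s t

/-- `x` and `y` have a nonzero common lower bound; when the meet `x ∧ y` exists this says
`x ∧ y ≠ 0`. -/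
def MeetsNonzero (x y : S) : Prop := ∃ z, z ≠ 0 ∧ NatLE z x ∧ NatLE z y

/-- The Lenz arrow `A → B`: every nonzero element below an element of `A` has
nonzero meet with some element of `B`. -/
def LenzArrow (A B : Set S) : Prop :=
  ∀ a ∈ A, ∀ x, x ≠ 0 → NatLE x a → ∃ b ∈ B, MeetsNonzero x b

/-- `A` is a finite cover of `a`: a finite set of elements below `a` with `a → A`. -/
def IsFiniteCover (a : S) (A : Set S) : Prop :=
  A.Finite ∧ (∀ x ∈ A, NatLE x a) ∧ LenzArrow {a} A

/-- The order ideal generated by a set. -/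
def lowerSet (X : Set S) : Set S := {y | ∃ x ∈ X, NatLE y x}

/-- Product of subsets. -/
def setMul (A B : Set S) : Set S := {x | ∃ a ∈ A, ∃ b ∈ B, x = a * b}

/-- Inverse of a subset. -/
def setInv (A : Set S) : Set S := {x | x⁻¹ ∈ A}

end Order

/-- An inverse `∧`-semigroup (always with zero): any two elements have a meet. -/
def IsInverseMeetSemigroup (S : Type*) [SemigroupWithZero S] [InverseSemigroup S] : Prop :=
  ∀ a b : S, ∃ m, IsMeetOf m a b

/-- A distributive inverse semigroup: finite nonempty compatible sets have joins, and
multiplication on either side distributes over these joins. -/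
def IsDistributiveInverse (S : Type*) [SemigroupWithZero S] [InverseSemigroup S] : Prop :=
  (∀ X : Set S, X.Finite → X.Nonempty → CompatibleSet X → ∃ j, IsJoinOf j X) ∧
  (∀ X : Set S, X.Finite → X.Nonempty → CompatibleSet X → ∀ j, IsJoinOf j X → ∀ a : S,
    IsJoinOf (a * j) ((fun x => a * x) '' X) ∧ IsJoinOf (j * a) ((fun x => x * a) '' X))

/-- A Boolean inverse semigroup: a distributive one whose idempotents form, under the natural
partial order, a (generalized, i.e. not necessarily unital) Boolean algebra. -/
def IsBooleanInverse (S : Type*) [SemigroupWithZero S] [InverseSemigroup S] : Prop :=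
  IsDistributiveInverse S ∧
  ∃ B : GeneralizedBooleanAlgebra {e : S // IsIdempotentElem e},
    ∀ e f : {e : S // IsIdempotentElem e}, B.le e f ↔ NatLE e.1 f.1

/-! ### Calculus of the natural order and of the Lenz arrow -/

namespace InverseSemigroup

section Calculus

variable {S : Type*} [SemigroupWithZero S] [InverseSemigroup S]

theorem natLE_mul_idem (b : S) {e : S} (he : e * e = e) : NatLE (b * e) b := by
  unfold NatLE
  rw [mul_inv_rev', inv_eq_self_of_idem he]
  calc b * e = (b * b⁻¹ * b) * (e * e) := by rw [mul_inv_mul, he]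
    _ = b * ((b⁻¹ * b) * e) * e := by simp only [mul_assoc]
    _ = b * (e * (b⁻¹ * b)) * e := by rw [idem_comm (idem_inv_mul b) he]
    _ = b * (e * b⁻¹ * (b * e)) := by simp only [mul_assoc]

theorem natLE_idem_mul (b : S) {e : S} (he : e * e = e) : NatLE (e * b) b := by
  have : e * b = b * (b⁻¹ * e * b) := by
    calc e * b = e * (b * b⁻¹ * b) := by rw [mul_inv_mul]
      _ = (e * (b * b⁻¹)) * b := by simp only [mul_assoc]
      _ = b * (b⁻¹ * e * b) := by
          rw [idem_comm he (idem_mul_inv b)]; simp only [mul_assoc]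
  rw [this]
  exact natLE_mul_idem b (conj_idem b he)

theorem NatLE.right {a b : S} (h : NatLE a b) : ∃ e : S, e * e = e ∧ a = b * e :=
  ⟨a⁻¹ * a, idem_inv_mul a, h⟩

theorem NatLE.left {a b : S} (h : NatLE a b) : ∃ e : S, e * e = e ∧ a = e * b := by
  obtain ⟨e, he, rfl⟩ := NatLE.right h
  refine ⟨b * e * b⁻¹, ?_, ?_⟩
  · simpa [inv_inv'] using conj_idem b⁻¹ he
  · calc b * e = (b * b⁻¹ * b) * e := by rw [mul_inv_mul]
      _ = b * ((b⁻¹ * b) * e) := by simp only [mul_assoc]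
      _ = b * e * b⁻¹ * b := by rw [idem_comm (idem_inv_mul b) he]; simp only [mul_assoc]

theorem natLE_refl (a : S) : NatLE a a := by
  unfold NatLE; rw [← mul_assoc, mul_inv_mul]

theorem NatLE.trans {a b c : S} (h : NatLE a b) (h' : NatLE b c) : NatLE a c := by
  obtain ⟨e, he, rfl⟩ := NatLE.right h
  obtain ⟨f, hf, rfl⟩ := NatLE.right h'
  rw [mul_assoc]
  exact natLE_mul_idem c (mul_idem hf he)

theorem NatLE.mul_right {a b : S} (h : NatLE a b) (c : S) : NatLE (a * c) (b * c) := by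
  obtain ⟨e, he, rfl⟩ := NatLE.left h
  rw [mul_assoc]; exact natLE_idem_mul _ he

theorem NatLE.mul_left {a b : S} (h : NatLE a b) (c : S) : NatLE (c * a) (c * b) := by
  obtain ⟨e, he, rfl⟩ := NatLE.right h
  rw [← mul_assoc]; exact natLE_mul_idem _ he

theorem NatLE.inv {a b : S} (h : NatLE a b) : NatLE a⁻¹ b⁻¹ := by
  obtain ⟨e, he, rfl⟩ := NatLE.right h
  rw [mul_inv_rev', inv_eq_self_of_idem he]; exact natLE_idem_mul _ he

theorem natLE_idem {e f : S} (h : NatLE e f) (hf : f * f = f) : e * e = e := by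
  obtain ⟨g, hg, rfl⟩ := NatLE.right h
  exact mul_idem hf hg

theorem zero_natLE (a : S) : NatLE 0 a := by simp [NatLE]

theorem LenzArrow.refl (A : Set S) : LenzArrow A A :=
  fun a ha x hx hxa => ⟨a, ha, x, hx, natLE_refl x, hxa⟩

theorem LenzArrow.trans {A B C : Set S} (h : LenzArrow A B) (h' : LenzArrow B C) :
    LenzArrow A C := by
  intro a ha x hx hxa
  obtain ⟨b, hb, z, hz, hzx, hzb⟩ := h a ha x hx hxa
  obtain ⟨c, hc, w, hw, hwz, hwc⟩ := h' b hb z hz hzb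
  exact ⟨c, hc, w, hw, NatLE.trans hwz hzx, hwc⟩

theorem LenzArrow.mul_right {A B : Set S} (h : LenzArrow A B) (C : Set S) :
    LenzArrow (setMul A C) (setMul B C) := by
  rintro _ ⟨a, ha, c, hc, rfl⟩ x hx hxac
  obtain ⟨e, he, hxe⟩ := NatLE.left hxac
  have hxc : x * c⁻¹ * c = x := by
    rw [hxe]; calc e * (a * c) * c⁻¹ * c = e * a * (c * c⁻¹ * c) := by simp only [mul_assoc]
      _ = _ := by rw [mul_inv_mul]; simp only [mul_assoc]
  have hy : x * c⁻¹ ≠ 0 := fun h0 => hx (by rw [← hxc, h0, zero_mul])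
  have hya : NatLE (x * c⁻¹) a := by
    refine NatLE.trans (NatLE.mul_right hxac c⁻¹) ?_
    rw [mul_assoc]; exact natLE_mul_idem _ (idem_mul_inv c)
  obtain ⟨b, hb, z, hz, hzy, hzb⟩ := h a ha _ hy hya
  refine ⟨b * c, ⟨b, hb, c, hc, rfl⟩, z * c, ?_, ?_, NatLE.mul_right hzb c⟩
  · intro h0
    obtain ⟨f, hf, hzf⟩ := NatLE.left hzy
    apply hz
    calc z = f * (x * (c⁻¹ * c * c⁻¹)) := by rw [inv_mul_inv]; exact hzf
      _ = (f * (x * c⁻¹)) * c * c⁻¹ := by simp only [mul_assoc]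
      _ = 0 := by rw [← hzf, h0, zero_mul]
  · have := NatLE.mul_right hzy c
    rwa [hxc] at this

theorem LenzArrow.mul_left {A B : Set S} (h : LenzArrow A B) (C : Set S) :
    LenzArrow (setMul C A) (setMul C B) := by
  rintro _ ⟨c, hc, a, ha, rfl⟩ x hx hxca
  obtain ⟨e, he, hxe⟩ := NatLE.right hxca
  have hxc : c * (c⁻¹ * x) = x := by
    rw [hxe]; calc c * (c⁻¹ * (c * a * e)) = (c * c⁻¹ * c) * a * e := by simp only [mul_assoc]
      _ = _ := by rw [mul_inv_mul]
  have hy : c⁻¹ * x ≠ 0 := fun h0 => hx (by rw [← hxc, h0, mul_zero])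
  have hya : NatLE (c⁻¹ * x) a := by
    refine NatLE.trans (NatLE.mul_left hxca c⁻¹) ?_
    rw [← mul_assoc]; exact natLE_idem_mul _ (idem_inv_mul c)
  obtain ⟨b, hb, z, hz, hzy, hzb⟩ := h a ha _ hy hya
  refine ⟨c * b, ⟨c, hc, b, hb, rfl⟩, c * z, ?_, ?_, NatLE.mul_left hzb c⟩
  · intro h0
    obtain ⟨f, hf, hzf⟩ := NatLE.right hzy
    apply hz
    calc z = ((c⁻¹ * c * c⁻¹) * x) * f := by rw [inv_mul_inv]; exact hzf
      _ = c⁻¹ * (c * ((c⁻¹ * x) * f)) := by simp only [mul_assoc]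
      _ = 0 := by rw [← hzf, h0, mul_zero]
  · have := NatLE.mul_left hzy c
    rwa [hxc] at this

theorem LenzArrow.inv {A B : Set S} (h : LenzArrow A B) :
    LenzArrow (setInv A) (setInv B) := by
  intro a ha x hx hxa
  have hx' : x⁻¹ ≠ 0 := by
    intro h0
    apply hx
    rw [← mul_inv_mul x, h0, mul_zero, zero_mul]
  obtain ⟨b, hb, z, hz, hzx, hzb⟩ := h a⁻¹ ha x⁻¹ hx' (NatLE.inv hxa)
  refine ⟨b⁻¹, by simpa [setInv, inv_inv'] using hb, z⁻¹, ?_, ?_, NatLE.inv hzb⟩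
  · intro h0
    apply hz
    rw [← mul_inv_mul z, h0, mul_zero, zero_mul]
  · simpa [inv_inv'] using NatLE.inv hzx

theorem setMul_singleton {S : Type*} [SemigroupWithZero S] (a b : S) : setMul {a} {b} = {a * b} := by
  ext x; simp [setMul]

theorem setInv_singleton (a : S) : setInv {a} = {a⁻¹} := by
  ext x
  simp only [setInv, Set.mem_ofPred_eq, Set.mem_singleton_iff]
  exact ⟨fun h => by rw [← h, inv_inv'], fun h => by rw [h, inv_inv']⟩

theorem setMul_assoc {S : Type*} [SemigroupWithZero S] (A B C : Set S) : setMul (setMul A B) C = setMul A (setMul B C) := by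
  ext x
  constructor
  · rintro ⟨_, ⟨a, ha, b, hb, rfl⟩, c, hc, rfl⟩
    exact ⟨a, ha, _, ⟨b, hb, c, hc, rfl⟩, mul_assoc _ _ _⟩
  · rintro ⟨a, ha, _, ⟨b, hb, c, hc, rfl⟩, rfl⟩
    exact ⟨_, ⟨a, ha, b, hb, rfl⟩, c, hc, (mul_assoc _ _ _).symm⟩

theorem natLE_of_mem_lower_mul {x a b : S} (h : NatLE x (a * b)) :
    ∃ b', NatLE b' b ∧ x = a * b' := by
  obtain ⟨e, he, rfl⟩ := NatLE.right h
  exact ⟨b * e, natLE_mul_idem b he, mul_assoc _ _ _⟩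

end Calculus

end InverseSemigroup

open InverseSemigroup in
/-- The congruence `a ↔ b`, i.e. `a → b` and `b → a`. -/
def lenzCon (S : Type*) [SemigroupWithZero S] [InverseSemigroup S] : Con S where
  r a b := LenzArrow {a} {b} ∧ LenzArrow {b} {a}
  iseqv :=
    { refl := fun _ => ⟨LenzArrow.refl _, LenzArrow.refl _⟩
      symm := fun h => ⟨h.2, h.1⟩
      trans := fun h h' => ⟨LenzArrow.trans h.1 h'.1, LenzArrow.trans h'.2 h.2⟩ }
  mul' := by
    intro w x y z h h'
    simp only [← setMul_singleton]
    exact ⟨LenzArrow.trans (LenzArrow.mul_right h.1 _) (LenzArrow.mul_left h'.1 _),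
      LenzArrow.trans (LenzArrow.mul_right h.2 _) (LenzArrow.mul_left h'.2 _)⟩

/-- The quotient of `S` by `↔`. -/
def LenzQuotient (S : Type*) [SemigroupWithZero S] [InverseSemigroup S] : Type _ :=
  (lenzCon S).Quotient

namespace LenzQuotient

open InverseSemigroup

/-- The quotient map. -/
def mk {S : Type*} [SemigroupWithZero S] [InverseSemigroup S] (a : S) : LenzQuotient S :=
  ((a : S) : (lenzCon S).Quotient)

section

variable {S : Type*} [SemigroupWithZero S] [InverseSemigroup S]

theorem ind {p : LenzQuotient S → Prop} (h : ∀ a, p (mk a)) (x : LenzQuotient S) : p x :=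
  Con.induction_on (c := lenzCon S) x h

end

instance (S : Type*) [SemigroupWithZero S] [InverseSemigroup S] :
    SemigroupWithZero (LenzQuotient S) :=
  { (inferInstance : Semigroup (lenzCon S).Quotient) with
    zero := mk 0
    zero_mul := ind fun a => congrArg mk (zero_mul a)
    mul_zero := ind fun a => congrArg mk (mul_zero a) }

instance (S : Type*) [MonoidWithZero S] [InverseSemigroup S] :
    MonoidWithZero (LenzQuotient S) :=
  { (inferInstance : SemigroupWithZero (LenzQuotient S)) with
    one := mk 1
    one_mul := ind fun a => congrArg mk (one_mul a)
    mul_one := ind fun a => congrArg mk (mul_one a) }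

instance (S : Type*) [SemigroupWithZero S] [InverseSemigroup S] : Inv (LenzQuotient S) where
  inv := Quotient.map (fun a : S => a⁻¹) (by
    intro a b h
    change LenzArrow {a⁻¹} {b⁻¹} ∧ LenzArrow {b⁻¹} {a⁻¹}
    simp only [← setInv_singleton]
    exact ⟨LenzArrow.inv h.1, LenzArrow.inv h.2⟩)

instance (S : Type*) [SemigroupWithZero S] [InverseSemigroup S] :
    InverseSemigroup (LenzQuotient S) :=
  ofEquational
    (ind fun a => congrArg mk (mul_inv_mul a))
    (ind fun a => congrArg mk (inv_inv' a))
    (ind fun a => ind fun b => congrArg mk (mul_inv_rev' a b))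
    (ind fun a => ind fun b => congrArg mk (idem_comm (idem_mul_inv a) (idem_mul_inv b)))

end LenzQuotient

/-! ### Finitely generated compatible order ideals -/

/-- The finitely generated compatible order ideals of `S`. -/
@[ext]
structure FinCompat (S : Type*) [SemigroupWithZero S] [InverseSemigroup S] where
  /-- The underlying set. -/
  carrier : Set S
  fg : ∃ X : Set S, X.Finite ∧ X.Nonempty ∧ carrier = lowerSet X
  compat : CompatibleSet carrier

namespace FinCompat

open InverseSemigroup

section

variable {S : Type*} [SemigroupWithZero S] [InverseSemigroup S]

theorem lower (A : FinCompat S) {a b : S} (h : NatLE b a) (ha : a ∈ A.carrier) : b ∈ A.carrier := by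
  obtain ⟨X, -, -, hX⟩ := A.fg
  rw [hX] at ha ⊢
  obtain ⟨x, hx, hax⟩ := ha
  exact ⟨x, hx, NatLE.trans h hax⟩

theorem compatible_of_natLE {a b x : S} (ha : NatLE a x) (hb : NatLE b x) : Compatible a b := by
  constructor
  · obtain ⟨e, he, rfl⟩ := NatLE.right ha
    obtain ⟨f, hf, rfl⟩ := NatLE.right hb
    rw [mul_inv_rev', inv_eq_self_of_idem he]
    have : e * x⁻¹ * (x * f) = e * ((x⁻¹ * x) * f) := by simp only [mul_assoc]
    rw [this]
    exact mul_idem he (mul_idem (idem_inv_mul x) hf)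
  · obtain ⟨e, he, rfl⟩ := NatLE.left ha
    obtain ⟨f, hf, rfl⟩ := NatLE.left hb
    rw [mul_inv_rev', inv_eq_self_of_idem hf]
    have : e * x * (x⁻¹ * f) = e * ((x * x⁻¹) * f) := by simp only [mul_assoc]
    rw [this]
    exact mul_idem he (mul_idem (idem_mul_inv x) hf)

/-- The principal order ideal generated by `s`. -/
def principal (s : S) : FinCompat S where
  carrier := lowerSet {s}
  fg := ⟨{s}, Set.finite_singleton s, Set.singleton_nonempty s, rfl⟩
  compat := by
    rintro a ⟨x, hx, ha⟩ b ⟨y, hy, hb⟩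
    rw [Set.mem_singleton_iff] at hx hy
    subst hx hy
    exact compatible_of_natLE ha hb

theorem mem_principal {s a : S} : a ∈ (principal s).carrier ↔ NatLE a s := by
  simp [principal, lowerSet]

/-- The product of two order ideals. -/
def mul (A B : FinCompat S) : FinCompat S where
  carrier := setMul A.carrier B.carrier
  fg := by
    obtain ⟨A, ⟨X, hXf, hXn, rfl⟩, hA⟩ := A
    obtain ⟨B, ⟨Y, hYf, hYn, rfl⟩, hB⟩ := B
    refine ⟨setMul X Y, ?_, ?_, ?_⟩
    · refine (Set.Finite.image2 (fun a b => a * b) hXf hYf).subset ?_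
      rintro _ ⟨a, ha, b, hb, rfl⟩
      exact ⟨a, ha, b, hb, rfl⟩
    · obtain ⟨x, hx⟩ := hXn
      obtain ⟨y, hy⟩ := hYn
      exact ⟨x * y, x, hx, y, hy, rfl⟩
    · ext z
      constructor
      · rintro ⟨a, ⟨x, hx, hax⟩, b, ⟨y, hy, hby⟩, rfl⟩
        exact ⟨x * y, ⟨x, hx, y, hy, rfl⟩,
          NatLE.trans (NatLE.mul_right hax b) (NatLE.mul_left hby x)⟩
      · rintro ⟨_, ⟨x, hx, y, hy, rfl⟩, h⟩
        obtain ⟨b, hb, rfl⟩ := natLE_of_mem_lower_mul h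
        exact ⟨x, ⟨x, hx, natLE_refl x⟩, b, ⟨y, hy, hb⟩, rfl⟩
  compat := by
      rintro _ ⟨a, ha, b, hb, rfl⟩ _ ⟨c, hc, d, hd, rfl⟩
      have hac := A.compat a ha c hc
      have hbd := B.compat b hb d hd
      constructor
      · rw [mul_inv_rev']
        have h : b⁻¹ * a⁻¹ * (c * d) = b⁻¹ * ((a⁻¹ * c) * d) := by simp only [mul_assoc]
        rw [h]
        exact natLE_idem (NatLE.mul_left (natLE_idem_mul d hac.1) b⁻¹) hbd.1
      · rw [mul_inv_rev']
        have h : a * b * (d⁻¹ * c⁻¹) = a * ((b * d⁻¹) * c⁻¹) := by simp only [mul_assoc]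
        rw [h]
        exact natLE_idem (NatLE.mul_left (natLE_idem_mul c⁻¹ hbd.2) a) hac.2

/-- The inverse of an order ideal. -/
def inv (A : FinCompat S) : FinCompat S where
  carrier := setInv A.carrier
  fg := by
    obtain ⟨A, ⟨X, hXf, hXn, rfl⟩, hA⟩ := A
    refine ⟨(fun x => x⁻¹) '' X, hXf.image _, hXn.image _, ?_⟩
    ext z
    constructor
    · rintro ⟨x, hx, h⟩
      exact ⟨x⁻¹, ⟨x, hx, rfl⟩, by simpa [inv_inv'] using NatLE.inv h⟩
    · rintro ⟨_, ⟨x, hx, rfl⟩, h⟩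
      exact ⟨x, hx, by simpa [inv_inv'] using NatLE.inv h⟩
  compat := by
      intro a ha b hb
      have h := A.compat _ ha _ hb
      exact ⟨by simpa [inv_inv'] using h.2, by simpa [inv_inv'] using h.1⟩

end

instance (S : Type*) [SemigroupWithZero S] [InverseSemigroup S] :
    SemigroupWithZero (FinCompat S) where
  mul := mul
  mul_assoc A B C := FinCompat.ext (setMul_assoc _ _ _)
  zero := principal 0
  zero_mul A := by
    refine FinCompat.ext (Set.ext fun x => ?_)
    refine Iff.trans ?_ mem_principal.symm
    constructor
    · rintro ⟨a, ha, b, hb, rfl⟩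
      have ha := NatLE.mul_right (mem_principal.1 ha) b
      rwa [zero_mul] at ha
    · intro h
      have hx : x = 0 := by simpa [NatLE] using h
      obtain ⟨A, ⟨X, -, ⟨y, hy⟩, rfl⟩, -⟩ := A
      exact ⟨0, mem_principal.2 (natLE_refl 0), y, ⟨y, hy, natLE_refl y⟩, by simp [hx]⟩
  mul_zero A := by
    refine FinCompat.ext (Set.ext fun x => ?_)
    refine Iff.trans ?_ mem_principal.symm
    constructor
    · rintro ⟨b, hb, a, ha, rfl⟩
      have ha := NatLE.mul_left (mem_principal.1 ha) b
      rwa [mul_zero] at ha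
    · intro h
      have hx : x = 0 := by simpa [NatLE] using h
      obtain ⟨A, ⟨X, -, ⟨y, hy⟩, rfl⟩, -⟩ := A
      exact ⟨y, ⟨y, hy, natLE_refl y⟩, 0, mem_principal.2 (natLE_refl 0), by simp [hx]⟩

theorem idem_of_natLE_one {S : Type*} [MonoidWithZero S] [InverseSemigroup S] {e : S}
    (h : NatLE e 1) : e * e = e := natLE_idem h (mul_one 1)

instance (S : Type*) [MonoidWithZero S] [InverseSemigroup S] :
    MonoidWithZero (FinCompat S) :=
  { (inferInstance : SemigroupWithZero (FinCompat S)) with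
    one := principal 1
    one_mul := by
      intro A
      refine FinCompat.ext (Set.ext fun x => ⟨?_, fun hx => ?_⟩)
      · rintro ⟨e, he, a, ha, rfl⟩
        exact A.lower (natLE_idem_mul a (idem_of_natLE_one (mem_principal.1 he))) ha
      · exact ⟨1, mem_principal.2 (natLE_refl 1), x, hx, (one_mul x).symm⟩
    mul_one := by
      intro A
      refine FinCompat.ext (Set.ext fun x => ⟨?_, fun hx => ?_⟩)
      · rintro ⟨a, ha, e, he, rfl⟩
        exact A.lower (natLE_mul_idem a (idem_of_natLE_one (mem_principal.1 he))) ha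
      · exact ⟨x, hx, 1, mem_principal.2 (natLE_refl 1), (mul_one x).symm⟩ }

instance (S : Type*) [SemigroupWithZero S] [InverseSemigroup S] : Inv (FinCompat S) := ⟨inv⟩

instance (S : Type*) [SemigroupWithZero S] [InverseSemigroup S] :
    InverseSemigroup (FinCompat S) :=
  ofEquational
    (by
      intro A
      refine FinCompat.ext (Set.ext fun x => ⟨?_, fun hx => ?_⟩)
      · rintro ⟨_, ⟨a, ha, b, hb, rfl⟩, c, hc, rfl⟩
        have h := (A.compat a ha b⁻¹ hb).2
        rw [inv_inv'] at h
        exact A.lower (natLE_idem_mul c h) hc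
      · exact ⟨x * x⁻¹, ⟨x, hx, x⁻¹, by
          change x⁻¹⁻¹ ∈ A.carrier
          rwa [inv_inv'], rfl⟩, x, hx, (mul_inv_mul x).symm⟩)
    (by
      intro A
      refine FinCompat.ext (Set.ext fun x => ?_)
      change x⁻¹⁻¹ ∈ A.carrier ↔ x ∈ A.carrier
      rw [inv_inv'])
    (by
      intro A B
      refine FinCompat.ext (Set.ext fun x => ⟨?_, ?_⟩)
      · rintro ⟨a, ha, b, hb, h⟩
        refine ⟨b⁻¹, ?_, a⁻¹, ?_, ?_⟩
        · change b⁻¹⁻¹ ∈ B.carrier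
          rwa [inv_inv']
        · change a⁻¹⁻¹ ∈ A.carrier
          rwa [inv_inv']
        · rw [← mul_inv_rev', ← h, inv_inv']
      · rintro ⟨b, hb, a, ha, rfl⟩
        exact ⟨a⁻¹, ha, b⁻¹, hb, mul_inv_rev' _ _⟩)
    (by
      have idem : ∀ A : FinCompat S, ∀ x ∈ (A * A⁻¹).carrier, x * x = x := by
        rintro A _ ⟨a, ha, b, hb, rfl⟩
        have h := (A.compat a ha b⁻¹ hb).2
        rw [inv_inv'] at h
        exact h
      intro A B
      refine FinCompat.ext (Set.ext fun x => ⟨?_, ?_⟩)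
      · rintro ⟨e, he, f, hf, rfl⟩
        exact ⟨f, hf, e, he, idem_comm (idem A e he) (idem B f hf)⟩
      · rintro ⟨e, he, f, hf, rfl⟩
        exact ⟨f, hf, e, he, idem_comm (idem B e he) (idem A f hf)⟩)

/-- The congruence `A ≡ B`, i.e. `A → B` and `B → A`. It does not matter whether the arrows are
taken between the order ideals, as here, or between finite generating sets of them. -/
def con (T : Type*) [SemigroupWithZero T] [InverseSemigroup T] : Con (FinCompat T) where
  r A B := LenzArrow A.carrier B.carrier ∧ LenzArrow B.carrier A.carrier
  iseqv :=
    { refl := fun _ => ⟨LenzArrow.refl _, LenzArrow.refl _⟩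
      symm := fun h => ⟨h.2, h.1⟩
      trans := fun h h' => ⟨LenzArrow.trans h.1 h'.1, LenzArrow.trans h'.2 h.2⟩ }
  mul' := fun h h' =>
    ⟨LenzArrow.trans (LenzArrow.mul_right h.1 _) (LenzArrow.mul_left h'.1 _),
      LenzArrow.trans (LenzArrow.mul_right h.2 _) (LenzArrow.mul_left h'.2 _)⟩

end FinCompat

/-! ### The distributive completion -/

/-- The distributive completion `D(S)`: the finitely generated compatible order ideals of `S/↔`,
modulo `≡`. -/
def DistribCompletion (S : Type*) [SemigroupWithZero S] [InverseSemigroup S] : Type _ :=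
  (FinCompat.con (LenzQuotient S)).Quotient

namespace DistribCompletion

open InverseSemigroup

/-- The class of an order ideal. -/
def mk {S : Type*} [SemigroupWithZero S] [InverseSemigroup S]
    (A : FinCompat (LenzQuotient S)) : DistribCompletion S :=
  (A : (FinCompat.con (LenzQuotient S)).Quotient)

theorem ind {S : Type*} [SemigroupWithZero S] [InverseSemigroup S]
    {p : DistribCompletion S → Prop} (h : ∀ A, p (mk A)) (x : DistribCompletion S) : p x :=
  Con.induction_on (c := FinCompat.con (LenzQuotient S)) x h

instance (S : Type*) [SemigroupWithZero S] [InverseSemigroup S] :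
    SemigroupWithZero (DistribCompletion S) :=
  { (inferInstance : Semigroup (FinCompat.con (LenzQuotient S)).Quotient) with
    zero := mk 0
    zero_mul := ind fun a => congrArg mk (zero_mul a)
    mul_zero := ind fun a => congrArg mk (mul_zero a) }

instance (S : Type*) [MonoidWithZero S] [InverseSemigroup S] :
    MonoidWithZero (DistribCompletion S) :=
  { (inferInstance : SemigroupWithZero (DistribCompletion S)) with
    one := mk 1
    one_mul := ind fun a => congrArg mk (one_mul a)
    mul_one := ind fun a => congrArg mk (mul_one a) }

instance (S : Type*) [SemigroupWithZero S] [InverseSemigroup S] :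
    Inv (DistribCompletion S) where
  inv := Quotient.map (fun A : FinCompat (LenzQuotient S) => A⁻¹)
    (fun _ _ h => ⟨LenzArrow.inv h.1, LenzArrow.inv h.2⟩)

instance (S : Type*) [SemigroupWithZero S] [InverseSemigroup S] :
    InverseSemigroup (DistribCompletion S) :=
  ofEquational
    (ind fun a => congrArg mk (mul_inv_mul a))
    (ind fun a => congrArg mk (inv_inv' a))
    (ind fun a => ind fun b => congrArg mk (mul_inv_rev' a b))
    (ind fun a => ind fun b => congrArg mk (idem_comm (idem_mul_inv a) (idem_mul_inv b)))

theorem principal_mul {S : Type*} [SemigroupWithZero S] [InverseSemigroup S] (a b : S) :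
    FinCompat.principal (a * b) = FinCompat.principal a * FinCompat.principal b := by
  refine FinCompat.ext (Set.ext fun x => ?_)
  refine Iff.trans FinCompat.mem_principal ?_
  constructor
  · intro h
    obtain ⟨b', hb', rfl⟩ := natLE_of_mem_lower_mul h
    exact ⟨a, FinCompat.mem_principal.2 (natLE_refl a), b', FinCompat.mem_principal.2 hb', rfl⟩
  · rintro ⟨a', ha', b', hb', rfl⟩
    exact NatLE.trans (NatLE.mul_right (FinCompat.mem_principal.1 ha') b')
      (NatLE.mul_left (FinCompat.mem_principal.1 hb') a)

/-- The canonical homomorphism `δ : S → D(S)`, sending `s` to the class of the principal order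
ideal generated by the `↔`-class of `s`. -/
def of (S : Type*) [SemigroupWithZero S] [InverseSemigroup S] : S →ₙ* DistribCompletion S where
  toFun s := mk (FinCompat.principal (LenzQuotient.mk s))
  map_mul' a b := congrArg mk (principal_mul (LenzQuotient.mk a) (LenzQuotient.mk b))

end DistribCompletion

/-- An inverse `∧`-semigroup is pre-Boolean if its distributive completion is Boolean. -/
def IsPreBoolean (S : Type*) [SemigroupWithZero S] [InverseSemigroup S] : Prop :=
  IsInverseMeetSemigroup S ∧ IsBooleanInverse (DistribCompletion S)

/-- A cover-to-join map: `θ(s)` is the join of `θ(A)` for every finite cover `A` of `s`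
(for `s = 0`, `A = ∅` this gives `θ(0) = 0`). -/
def IsCoverToJoin {S T : Type*} [SemigroupWithZero S] [InverseSemigroup S]
    [SemigroupWithZero T] [InverseSemigroup T] (θ : S →ₙ* T) : Prop :=
  ∀ (s : S) (A : Set S), IsFiniteCover s A → IsJoinOf (θ s) (θ '' A)

/-- A homomorphism preserving all joins of finite compatible sets (the empty join, that is the
zero, included). -/
def IsJoinPreserving {S T : Type*} [SemigroupWithZero S] [InverseSemigroup S]
    [SemigroupWithZero T] [InverseSemigroup T] (θ : S →ₙ* T) : Prop :=
  ∀ (X : Set S) (j : S), X.Finite → CompatibleSet X → IsJoinOf j X → IsJoinOf (θ j) (θ '' X)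

/-- `δ : S → D` exhibits `D` as the Boolean completion of `S`: `D` is a Boolean inverse
`∧`-semigroup, `δ` is a `0`-restricted cover-to-join homomorphism, and every cover-to-join
homomorphism from `S` to a distributive inverse semigroup extends uniquely along `δ` to a
join-preserving homomorphism. -/
def IsBooleanCompletion.{v, u, w} {S : Type u} {D : Type w} [SemigroupWithZero S]
    [InverseSemigroup S] [SemigroupWithZero D] [InverseSemigroup D] (δ : S →ₙ* D) : Prop :=
  IsInverseMeetSemigroup D ∧ IsBooleanInverse D ∧
  (∀ s, δ s = 0 → s = 0) ∧ IsCoverToJoin δ ∧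
  ∀ (T : Type v) [SemigroupWithZero T] [InverseSemigroup T], IsDistributiveInverse T →
    ∀ θ : S →ₙ* T, IsCoverToJoin θ →
      ∃! θ' : D →ₙ* T, IsJoinPreserving θ' ∧ θ'.comp δ = θ

/-- A semigroup is congruence-free if it has exactly two congruences: equality and the
universal one. -/
def IsCongruenceFree (S : Type*) [Mul S] : Prop := IsSimpleOrder (Con S)

/-! ### The polycyclic monoids -/

/-- The defining relations `aᵢ⁻¹ aᵢ = 1` and `aᵢ⁻¹ aⱼ = 0` (`i ≠ j`) of the polycyclic monoid, on
the free monoid with zero on the letters `aᵢ = inl i` and `aᵢ⁻¹ = inr i`. -/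
inductive PolycyclicRel (n : ℕ) : WithZero (FreeMonoid (Fin n ⊕ Fin n)) →
    WithZero (FreeMonoid (Fin n ⊕ Fin n)) → Prop
  | cancel (i : Fin n) : PolycyclicRel n
      ((FreeMonoid.of (Sum.inr i) * FreeMonoid.of (Sum.inl i) :
        FreeMonoid (Fin n ⊕ Fin n)) : WithZero (FreeMonoid (Fin n ⊕ Fin n))) 1
  | ortho (i j : Fin n) (h : i ≠ j) : PolycyclicRel n
      ((FreeMonoid.of (Sum.inr i) * FreeMonoid.of (Sum.inl j) :
        FreeMonoid (Fin n ⊕ Fin n)) : WithZero (FreeMonoid (Fin n ⊕ Fin n))) 0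

/-- The polycyclic monoid on `n` letters, presented as a monoid with zero. -/
def Polycyclic (n : ℕ) : Type := (conGen (PolycyclicRel n)).Quotient

namespace Polycyclic

open InverseSemigroup

section

variable {n : ℕ}

/-- The quotient map from the free monoid with zero. -/
def mk (w : WithZero (FreeMonoid (Fin n ⊕ Fin n))) : Polycyclic n :=
  (w : (conGen (PolycyclicRel n)).Quotient)

theorem ind {p : Polycyclic n → Prop} (h : ∀ w, p (mk w)) (x : Polycyclic n) : p x :=
  Con.induction_on (c := conGen (PolycyclicRel n)) x h

instance : MonoidWithZero (Polycyclic n) :=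
  { (inferInstance : Monoid (conGen (PolycyclicRel n)).Quotient) with
    zero := mk 0
    zero_mul := ind fun a => congrArg mk (zero_mul a)
    mul_zero := ind fun a => congrArg mk (mul_zero a) }

theorem mk_mul (v w : WithZero (FreeMonoid (Fin n ⊕ Fin n))) : mk (v * w) = mk v * mk w := rfl

/-- The generators: `letter (inl i)` is `aᵢ` and `letter (inr i)` is `aᵢ⁻¹`. -/
def letter (x : Fin n ⊕ Fin n) : Polycyclic n :=
  mk ((FreeMonoid.of x : FreeMonoid (Fin n ⊕ Fin n)) : WithZero (FreeMonoid (Fin n ⊕ Fin n)))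

theorem letter_cancel (i : Fin n) :
    (letter (Sum.inr i) * letter (Sum.inl i) : Polycyclic n) = 1 := by
  exact (Con.eq (conGen (PolycyclicRel n))).2 (ConGen.Rel.of _ _ (PolycyclicRel.cancel i))

theorem letter_ortho {i j : Fin n} (h : i ≠ j) :
    (letter (Sum.inr i) * letter (Sum.inl j) : Polycyclic n) = 0 := by
  exact (Con.eq (conGen (PolycyclicRel n))).2 (ConGen.Rel.of _ _ (PolycyclicRel.ortho i j h))

/-- The anti-homomorphism exchanging `aᵢ` and `aᵢ⁻¹`, on words. -/
def invWord (n : ℕ) : WithZero (FreeMonoid (Fin n ⊕ Fin n)) →*₀ (Polycyclic n)ᵐᵒᵖ :=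
  WithZero.lift' (FreeMonoid.lift fun x => MulOpposite.op (letter x.swap))

theorem invWord_le (n : ℕ) :
    conGen (PolycyclicRel n) ≤ Con.ker (invWord n).toMonoidHom := by
  rw [Con.conGen_le]
  intro a b h
  change invWord n a = invWord n b
  cases h with
  | cancel i =>
    rw [map_one, invWord, WithZero.lift'_coe]
    simp [← MulOpposite.op_mul, letter_cancel]
  | ortho i j h =>
    rw [map_zero, invWord, WithZero.lift'_coe]
    simp [← MulOpposite.op_mul, letter_ortho h.symm]

/-- The anti-homomorphism of the polycyclic monoid exchanging `aᵢ` and `aᵢ⁻¹`. -/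
def invHom (n : ℕ) : Polycyclic n →* (Polycyclic n)ᵐᵒᵖ :=
  (conGen (PolycyclicRel n)).lift _ (invWord_le n)

/-- The inverse is determined by `(xy)⁻¹ = y⁻¹x⁻¹` and by exchanging `aᵢ` and `aᵢ⁻¹`. -/
instance : Inv (Polycyclic n) := ⟨fun x => MulOpposite.unop (invHom n x)⟩

theorem letter_inv (x : Fin n ⊕ Fin n) : (letter x)⁻¹ = letter x.swap := by
  change MulOpposite.unop (invWord n ((FreeMonoid.of x : FreeMonoid (Fin n ⊕ Fin n)) :
    WithZero (FreeMonoid (Fin n ⊕ Fin n)))) = _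
  rw [invWord, WithZero.lift'_coe, FreeMonoid.lift_eval_of]
  rfl

theorem inv_mul_rev (x y : Polycyclic n) : (x * y)⁻¹ = y⁻¹ * x⁻¹ := by
  change MulOpposite.unop (invHom n (x * y)) = _
  rw [map_mul]; rfl

theorem inv_one' : (1 : Polycyclic n)⁻¹ = 1 := by
  change MulOpposite.unop (invHom n 1) = _
  rw [map_one]; rfl

theorem inv_zero' : (0 : Polycyclic n)⁻¹ = 0 := by
  change MulOpposite.unop (invWord n 0) = _
  rw [map_zero]; rfl

theorem induction {p : Polycyclic n → Prop} (h0 : p 0) (h1 : p 1)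
    (hm : ∀ x w, p w → p (letter x * w)) (w : Polycyclic n) : p w := by
  induction w using Polycyclic.ind with
  | h w =>
    induction w using WithZero.recZeroCoe with
    | zero => exact h0
    | coe w =>
      induction w using FreeMonoid.recOn with
      | one => exact h1
      | of_mul x w ih => exact hm x _ ih

theorem inv_involutive (x : Polycyclic n) : x⁻¹⁻¹ = x := by
  induction x using Polycyclic.induction with
  | h0 => rw [inv_zero', inv_zero']
  | h1 => rw [inv_one', inv_one']
  | hm x w ih => rw [inv_mul_rev, inv_mul_rev, ih, letter_inv, letter_inv, Sum.swap_swap]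

/-- The positive word `u`, as an element of the polycyclic monoid. -/
def pos (u : List (Fin n)) : Polycyclic n := (u.map fun i => letter (Sum.inl i)).prod

theorem pos_append (u v : List (Fin n)) : pos (u ++ v) = pos u * pos v := by
  simp [pos]

theorem pos_cons (i : Fin n) (v : List (Fin n)) : pos (i :: v) = letter (Sum.inl i) * pos v := by
  simp [pos]

theorem pos_nil : pos ([] : List (Fin n)) = 1 := rfl

theorem pos_inv_mul (u : List (Fin n)) : (pos u)⁻¹ * pos u = 1 := by
  induction u with
  | nil => rw [pos_nil, inv_one', one_mul]
  | cons i u ih =>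
    rw [pos_cons, inv_mul_rev, letter_inv, mul_assoc, ← mul_assoc (letter _) (letter _)]
    rw [show (Sum.inl i : Fin n ⊕ Fin n).swap = Sum.inr i from rfl, letter_cancel, one_mul, ih]

/-- Every element is zero or of the form `y x⁻¹` with `x`, `y` positive. -/
theorem normalForm (w : Polycyclic n) : w = 0 ∨ ∃ y x, w = pos y * (pos x)⁻¹ := by
  induction w using Polycyclic.induction with
  | h0 => exact Or.inl rfl
  | h1 => exact Or.inr ⟨[], [], by rw [pos_nil, inv_one', one_mul]⟩
  | hm a w ih =>
    rcases ih with rfl | ⟨y, x, rfl⟩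
    · exact Or.inl (mul_zero _)
    · rcases a with i | i
      · exact Or.inr ⟨i :: y, x, by rw [pos_cons, mul_assoc]⟩
      · rcases y with _ | ⟨j, y⟩
        · refine Or.inr ⟨[], x ++ [i], ?_⟩
          rw [pos_append, inv_mul_rev, pos_nil, one_mul, one_mul, pos_cons, pos_nil, mul_one,
            letter_inv]
          rfl
        · by_cases h : i = j
          · subst h
            refine Or.inr ⟨y, x, ?_⟩
            rw [pos_cons, mul_assoc, ← mul_assoc (letter _) (letter _), letter_cancel, one_mul]
          · left
            rw [pos_cons, mul_assoc, ← mul_assoc (letter _) (letter _), letter_ortho h, zero_mul]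

/-- Two positive words are prefix-comparable or orthogonal. -/
theorem pos_compare (u v : List (Fin n)) :
    (pos u)⁻¹ * pos v = 0 ∨ (∃ w, v = u ++ w) ∨ ∃ w, u = v ++ w := by
  induction u generalizing v with
  | nil => exact Or.inr (Or.inl ⟨v, rfl⟩)
  | cons i u ih =>
    rcases v with _ | ⟨j, v⟩
    · exact Or.inr (Or.inr ⟨i :: u, rfl⟩)
    · by_cases h : i = j
      · subst h
        rcases ih v with h | ⟨w, rfl⟩ | ⟨w, rfl⟩
        · left
          rw [pos_cons, pos_cons, inv_mul_rev, letter_inv, mul_assoc,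
            ← mul_assoc (letter _) (letter _),
            show (Sum.inl i : Fin n ⊕ Fin n).swap = Sum.inr i from rfl, letter_cancel, one_mul, h]
        · exact Or.inr (Or.inl ⟨w, rfl⟩)
        · exact Or.inr (Or.inr ⟨w, rfl⟩)
      · left
        rw [pos_cons, pos_cons, inv_mul_rev, letter_inv, mul_assoc,
          ← mul_assoc (letter _) (letter _),
          show (Sum.inl i : Fin n ⊕ Fin n).swap = Sum.inr i from rfl, letter_ortho h, zero_mul,
          mul_zero]

theorem mul_inv_eq (w : Polycyclic n) : w * w⁻¹ = 0 ∨ ∃ y, w * w⁻¹ = pos y * (pos y)⁻¹ := by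
  rcases normalForm w with rfl | ⟨y, x, rfl⟩
  · exact Or.inl (zero_mul _)
  · refine Or.inr ⟨y, ?_⟩
    rw [inv_mul_rev, inv_involutive, mul_assoc, ← mul_assoc (pos x)⁻¹, pos_inv_mul, one_mul]

theorem pos_idem_comm (u v : List (Fin n)) :
    (pos u * (pos u)⁻¹) * (pos v * (pos v)⁻¹) = (pos v * (pos v)⁻¹) * (pos u * (pos u)⁻¹) := by
  have key : ∀ u w : List (Fin n), (pos u * (pos u)⁻¹) * (pos (u ++ w) * (pos (u ++ w))⁻¹)
      = pos (u ++ w) * (pos (u ++ w))⁻¹ := by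
    intro u w
    rw [pos_append]
    calc _ = pos u * ((pos u)⁻¹ * pos u) * (pos w * (pos u * pos w)⁻¹) := by
          simp only [mul_assoc]
      _ = _ := by rw [pos_inv_mul, mul_one, mul_assoc]
  have key' : ∀ u w : List (Fin n), (pos (u ++ w) * (pos (u ++ w))⁻¹) * (pos u * (pos u)⁻¹)
      = pos (u ++ w) * (pos (u ++ w))⁻¹ := by
    intro u w
    rw [pos_append, inv_mul_rev]
    calc _ = pos u * pos w * (pos w)⁻¹ * ((pos u)⁻¹ * pos u) * (pos u)⁻¹ := by
          simp only [mul_assoc]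
      _ = _ := by rw [pos_inv_mul, mul_one]; simp only [mul_assoc]
  rcases pos_compare u v with h | ⟨w, rfl⟩ | ⟨w, rfl⟩
  · have h' : (pos v)⁻¹ * pos u = 0 := by
      have := congrArg (fun x => x⁻¹) h
      simpa only [inv_mul_rev, inv_involutive, inv_zero'] using this
    calc _ = pos u * ((pos u)⁻¹ * pos v) * (pos v)⁻¹ := by simp only [mul_assoc]
      _ = pos v * ((pos v)⁻¹ * pos u) * (pos u)⁻¹ := by simp only [h, h', mul_zero, zero_mul]
      _ = _ := by simp only [mul_assoc]
  · rw [key, key']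
  · rw [key, key']

instance : InverseSemigroup (Polycyclic n) :=
  ofEquational
    (by
      intro w
      rcases normalForm w with rfl | ⟨y, x, rfl⟩
      · rw [mul_zero]
      · rw [inv_mul_rev, inv_involutive]
        calc _ = pos y * ((pos x)⁻¹ * pos x) * ((pos y)⁻¹ * pos y) * (pos x)⁻¹ := by
              simp only [mul_assoc]
          _ = _ := by rw [pos_inv_mul, pos_inv_mul, mul_one, mul_one])
    inv_involutive inv_mul_rev
    (by
      intro a b
      rcases mul_inv_eq a with h | ⟨u, h⟩
      · rw [h, zero_mul, mul_zero]
      · rcases mul_inv_eq b with h' | ⟨v, h'⟩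
        · rw [h', zero_mul, mul_zero]
        · rw [h, h', pos_idem_comm])

end

end Polycyclic

/-- The Cuntz inverse monoid `Cₙ`, the completion `D(Pₙ)` of the polycyclic monoid `Pₙ`. -/
abbrev CuntzInverseMonoid (n : ℕ) : Type := DistribCompletion (Polycyclic n)

/-! ### The Higman-Thompson groups -/

/-- The free right act on `r` generators over the free monoid on `n` letters; a word is a list of
letters. -/
abbrev FreeAct (n r : ℕ) : Type := Fin r × List (Fin n)

namespace FreeAct

variable {n r : ℕ}

/-- The right action of words. -/
def act (x : FreeAct n r) (u : List (Fin n)) : FreeAct n r := (x.1, x.2 ++ u)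

theorem act_act (x : FreeAct n r) (u v : List (Fin n)) : (x.act u).act v = x.act (u ++ v) := by
  simp [act]

theorem act_nil (x : FreeAct n r) : x.act [] = x := by simp [act]

/-- A subact: a subset closed under the action. -/
def IsSubact (Y : Set (FreeAct n r)) : Prop := ∀ x ∈ Y, ∀ u, x.act u ∈ Y

/-- A subact is essential if it meets every nonempty subact. -/
def IsEssential (Y : Set (FreeAct n r)) : Prop :=
  ∀ Z : Set (FreeAct n r), IsSubact Z → Z.Nonempty → (Y ∩ Z).Nonempty

/-- A subset is a finitely generated subact if it is a finite union of cyclic subacts. -/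
def IsFinGen (Y : Set (FreeAct n r)) : Prop :=
  ∃ F : Set (FreeAct n r), F.Finite ∧ Y = {y | ∃ x ∈ F, ∃ u, y = x.act u}

end FreeAct

section HigmanThompsonDefs

open FreeAct

/-- The domain of definition of a partial bijection (that of `f.symm` is the range of `f`). -/
def pequivDom {α : Type*} (f : α ≃. α) : Set α := {x | (f x).isSome}

/-- `f` is an isomorphism between two finitely generated essential subacts of the free act. -/
structure IsEssentialIso {n r : ℕ} (f : FreeAct n r ≃. FreeAct n r) : Prop where
  equivariant : ∀ x y, y ∈ f x → ∀ u, y.act u ∈ f (x.act u)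
  dom_finGen : IsFinGen (pequivDom f)
  dom_essential : IsEssential (pequivDom f)
  ran_finGen : IsFinGen (pequivDom f.symm)
  ran_essential : IsEssential (pequivDom f.symm)

namespace IsEssentialIso

variable {n r : ℕ}

theorem mem_dom {α : Type*} {f : α ≃. α} {x : α} : x ∈ pequivDom f ↔ ∃ y, y ∈ f x := by
  simp [pequivDom, Option.isSome_iff_exists]

protected theorem symm {f : FreeAct n r ≃. FreeAct n r} (h : IsEssentialIso f) :
    IsEssentialIso f.symm where
  equivariant x y hy u := f.mem_iff_mem.2 (h.equivariant y x (f.mem_iff_mem.1 hy) u)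
  dom_finGen := h.ran_finGen
  dom_essential := h.ran_essential
  ran_finGen := h.dom_finGen
  ran_essential := h.dom_essential

protected theorem refl : IsEssentialIso (PEquiv.refl (FreeAct n r)) := by
  have hd : pequivDom (PEquiv.refl (FreeAct n r)) = Set.univ := by
    ext x; simp [pequivDom]
  have hf : IsFinGen (Set.univ : Set (FreeAct n r)) := by
    refine ⟨Set.range fun i : Fin r => (i, []), Set.finite_range _, ?_⟩
    ext x
    simp only [Set.mem_univ, true_iff]
    exact ⟨(x.1, []), ⟨x.1, rfl⟩, x.2, by simp [act]⟩
  have he : IsEssential (Set.univ : Set (FreeAct n r)) := by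
    intro Z _ hZ
    rwa [Set.univ_inter]
  refine ⟨?_, ?_, ?_, ?_, ?_⟩
  · intro x y h u
    simp only [PEquiv.refl_apply, Option.mem_def, Option.some.injEq] at h ⊢
    rw [h]
  · rwa [hd]
  · rwa [hd]
  · rwa [PEquiv.symm_refl, hd]
  · rwa [PEquiv.symm_refl, hd]

theorem exists_act {f : FreeAct n r ≃. FreeAct n r} (h : IsEssentialIso f) (x : FreeAct n r) :
    ∃ u, x.act u ∈ pequivDom f := by
  obtain ⟨_, hz, u, rfl⟩ := h.dom_essential {y | ∃ u, y = x.act u}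
    (by rintro _ ⟨u, rfl⟩ v; exact ⟨u ++ v, act_act x u v⟩) ⟨_, [], rfl⟩
  exact ⟨u, hz⟩

theorem trans_dom {f g : FreeAct n r ≃. FreeAct n r} (hf : IsEssentialIso f)
    (hg : IsEssentialIso g) :
    IsFinGen (pequivDom (f.trans g)) ∧ IsEssential (pequivDom (f.trans g)) := by
  have hmem : ∀ x, x ∈ pequivDom (f.trans g) ↔ ∃ y, y ∈ f x ∧ y ∈ pequivDom g := by
    intro x
    simp only [mem_dom, PEquiv.mem_trans]
    constructor
    · rintro ⟨z, y, hy, hz⟩; exact ⟨y, hy, z, hz⟩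
    · rintro ⟨y, hy, z, hz⟩; exact ⟨z, y, hy, hz⟩
  have hgsub : ∀ y ∈ pequivDom g, ∀ u, y.act u ∈ pequivDom g := by
    intro y hy u
    obtain ⟨z, hz⟩ := mem_dom.1 hy
    exact mem_dom.2 ⟨_, hg.equivariant y z hz u⟩
  constructor
  · obtain ⟨F, hF, hFd⟩ := hf.dom_finGen
    obtain ⟨G, hG, hGd⟩ := hg.dom_finGen
    refine ⟨{x | (x ∈ F ∨ ∃ q ∈ G, q ∈ f x) ∧ x ∈ pequivDom (f.trans g)}, ?_, ?_⟩
    · have hfin : (⋃ q ∈ G, {x | q ∈ f x}).Finite := by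
        refine hG.biUnion fun q _ => Set.Subsingleton.finite ?_
        intro x hx y hy
        exact f.inj hx hy
      refine (hF.union hfin).subset ?_
      rintro x ⟨hx | ⟨q, hq, hqx⟩, -⟩
      · exact Or.inl hx
      · exact Or.inr (Set.mem_biUnion hq hqx)
    · ext x
      constructor
      · intro hx
        obtain ⟨y, hy, hyg⟩ := (hmem x).1 hx
        have hxF : x ∈ pequivDom f := mem_dom.2 ⟨y, hy⟩
        rw [hFd] at hxF
        obtain ⟨p, hp, w, rfl⟩ := hxF
        have hpf : p ∈ pequivDom f := by rw [hFd]; exact ⟨p, hp, [], (act_nil p).symm⟩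
        obtain ⟨p', hp'⟩ := mem_dom.1 hpf
        have hyp : y = p'.act w := Option.mem_unique hy (hf.equivariant p p' hp' w)
        rw [hGd] at hyg
        obtain ⟨q, hq, t, hqt⟩ := hyg
        have hqg : q ∈ pequivDom g := by rw [hGd]; exact ⟨q, hq, [], (act_nil q).symm⟩
        have h1 : p'.1 = q.1 := by
          have h := congrArg Prod.fst (hyp.symm.trans hqt)
          exact h
        have h2 : p'.2 ++ w = q.2 ++ t := by
          have h := congrArg Prod.snd (hyp.symm.trans hqt)
          exact h
        rcases List.append_eq_append_iff.1 h2 with ⟨v, hv1, hv2⟩ | ⟨v, hv1, hv2⟩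
        · have hq' : q = p'.act v := Prod.ext h1.symm hv1
          have hqf : q ∈ f (p.act v) := by rw [hq']; exact hf.equivariant p p' hp' v
          refine ⟨p.act v, ⟨Or.inr ⟨q, hq, hqf⟩, (hmem _).2 ⟨q, hqf, hqg⟩⟩, t, ?_⟩
          rw [act_act, hv2]
        · have hp'' : p' = q.act v := Prod.ext h1 hv1
          refine ⟨p, ⟨Or.inl hp, (hmem _).2 ⟨p', hp', ?_⟩⟩, w, rfl⟩
          rw [hp'']; exact hgsub q hqg v
      · rintro ⟨p, ⟨-, hp⟩, u, rfl⟩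
        obtain ⟨y, hy, hyg⟩ := (hmem p).1 hp
        exact (hmem _).2 ⟨_, hf.equivariant p y hy u, hgsub y hyg u⟩
  · rintro Z hZ ⟨x, hx⟩
    obtain ⟨u, hu⟩ := hf.exists_act x
    obtain ⟨y, hy⟩ := mem_dom.1 hu
    obtain ⟨v, hv⟩ := hg.exists_act y
    exact ⟨(x.act u).act v, (hmem _).2 ⟨_, hf.equivariant _ _ hy v, hv⟩, hZ _ (hZ x hx u) v⟩

protected theorem trans {f g : FreeAct n r ≃. FreeAct n r} (hf : IsEssentialIso f)
    (hg : IsEssentialIso g) : IsEssentialIso (f.trans g) where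
  equivariant x z hz u := by
    obtain ⟨y, hy, hz⟩ := (PEquiv.mem_trans f g x z).1 hz
    exact (PEquiv.mem_trans f g _ _).2 ⟨_, hf.equivariant x y hy u, hg.equivariant y z hz u⟩
  dom_finGen := (trans_dom hf hg).1
  dom_essential := (trans_dom hf hg).2
  ran_finGen := (trans_dom hg.symm hf.symm).1
  ran_essential := (trans_dom hg.symm hf.symm).2

end IsEssentialIso

/-- The inverse monoid of isomorphisms between finitely generated essential subacts of the free
act on `r` generators over the free monoid on `n` letters, under composition of partial maps. -/
def EssentialIso (n r : ℕ) : Type := {f : FreeAct n r ≃. FreeAct n r // IsEssentialIso f}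

namespace EssentialIso

variable {n r : ℕ}

/-- The product `f * g` is `f` after `g`. -/
instance : Monoid (EssentialIso n r) where
  mul f g := ⟨g.1.trans f.1, g.2.trans f.2⟩
  one := ⟨PEquiv.refl _, IsEssentialIso.refl⟩
  mul_assoc f g h := Subtype.ext (PEquiv.trans_assoc h.1 g.1 f.1).symm
  one_mul f := Subtype.ext (PEquiv.trans_refl f.1)
  mul_one f := Subtype.ext (PEquiv.refl_trans f.1)

/-- The inverse partial bijection. -/
def inv (f : EssentialIso n r) : EssentialIso n r := ⟨f.1.symm, f.2.symm⟩

/-- The minimum group congruence: two isomorphisms are identified if they have a common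
restriction to a finitely generated essential subact. -/
def sigma (n r : ℕ) : Con (EssentialIso n r) where
  r f g := ∃ h : EssentialIso n r, h.1 ≤ f.1 ∧ h.1 ≤ g.1
  iseqv :=
    { refl := fun f => ⟨f, le_rfl, le_rfl⟩
      symm := fun ⟨h, h1, h2⟩ => ⟨h, h2, h1⟩
      trans := by
        rintro f g k ⟨h, hf, hg⟩ ⟨h', hg', hk'⟩
        refine ⟨h * (h'.inv * h'), ?_, ?_⟩
        · intro x z hz
          obtain ⟨y, hy, hz⟩ := (PEquiv.mem_trans _ _ x z).1 hz
          obtain ⟨w, hw, hy⟩ := (PEquiv.mem_trans _ _ x y).1 hy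
          have hxy : x = y := h'.1.inj hw (h'.1.mem_iff_mem.1 hy)
          subst hxy
          exact hf _ _ hz
        · intro x z hz
          obtain ⟨y, hy, hz⟩ := (PEquiv.mem_trans _ _ x z).1 hz
          obtain ⟨w, hw, hy⟩ := (PEquiv.mem_trans _ _ x y).1 hy
          have hxy : x = y := h'.1.inj hw (h'.1.mem_iff_mem.1 hy)
          subst hxy
          have hzw : z = w := Option.mem_unique (hg _ _ hz) (hg' _ _ hw)
          subst hzw
          exact hk' _ _ hw }
  mul' := by
    rintro f f' g g' ⟨h, h1, h2⟩ ⟨k, k1, k2⟩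
    refine ⟨h * k, ?_, ?_⟩
    · intro x z hz
      obtain ⟨y, hy, hz⟩ := (PEquiv.mem_trans _ _ x z).1 hz
      exact (PEquiv.mem_trans _ _ x z).2 ⟨y, k1 _ _ hy, h1 _ _ hz⟩
    · intro x z hz
      obtain ⟨y, hy, hz⟩ := (PEquiv.mem_trans _ _ x z).1 hz
      exact (PEquiv.mem_trans _ _ x z).2 ⟨y, k2 _ _ hy, h2 _ _ hz⟩

end EssentialIso

/-- The Higman-Thompson group `G_{n,r}`: the maximum group image of the inverse monoid of
isomorphisms between the finitely generated essential subacts of the free act on `r` generators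
over the free monoid on `n` letters. -/
def HigmanThompson (n r : ℕ) : Type := (EssentialIso.sigma n r).Quotient

namespace HigmanThompson

variable {n r : ℕ}

instance : Group (HigmanThompson n r) :=
  { (inferInstance : Monoid (EssentialIso.sigma n r).Quotient) with
    inv := Quotient.map (fun f : EssentialIso n r => f.inv) (by
      rintro f g ⟨h, h1, h2⟩
      exact ⟨h.inv, fun x y hy => h1 _ _ (h.1.mem_iff_mem.1 hy) |> f.1.mem_iff_mem.2,
        fun x y hy => h2 _ _ (h.1.mem_iff_mem.1 hy) |> g.1.mem_iff_mem.2⟩)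
    inv_mul_cancel := by
      intro a
      induction a using Quotient.inductionOn with
      | h f =>
        refine Quotient.sound ⟨f.inv * f, le_rfl, ?_⟩
        intro x z hz
        obtain ⟨y, hy, hz⟩ := (PEquiv.mem_trans _ _ x z).1 hz
        have hxz : x = z := f.1.inj hy (f.1.mem_iff_mem.1 hz)
        subst hxz
        rfl }

end HigmanThompson

end HigmanThompsonDefs

universe v

/-! Let `P_n` act on infinite sequences of letters: `a_i` prepends `i` and `a_i⁻¹` removes it, so
`pos y * (pos x)⁻¹` becomes the partial injection `prefixRel y x` that replaces the prefix `x` by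
`y`. Only aperiodic sequences are admitted. On them words act freely (`app_free`), so of two prefix
replacements that agree at a single point one is a restriction of the other (`prefixRel_compare`).
On all sequences this fails: `a_i` and `1` have meet zero but agree at the constant sequence `i`.

In this faithful picture the natural order is inclusion, meets are intersections, and compatibility
says that the union is still a partial injection. A finite union of prefix replacements is closed
(`exists_separating`), and a prefix replacement can be shrunk around each of its points. Hence for
finite `B` the arrow `A → B` says exactly that the union of `A` lies in the union of `B`
(`lenzArrow_of_subset`, `subset_of_lenzArrow`). So `↔` is equality on `P_n`, `≡` is equality of
unions, and `C_n` is the semigroup of all partial injections that are finite unions of prefix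
replacements (`isPrefixUnionRep_completionRep`).

Everything is read off from this model. Such unions are stable under intersection and difference,
which gives meets, distributivity and the Boolean algebra of idempotents. A cover-to-join `θ`
extends by sending an element to the join of `θ` over any finite decomposition of it into prefix
replacements; independence of the decomposition is what cover-to-join provides. If a congruence
identifies two distinct elements, zooming in on a point of one that is not in the other identifies
`1` with `0`.

The units are the bijections in the model. An isomorphism of finitely generated essential subacts
induces one on sequences (`boundaryRel`), two isomorphisms induce the same one exactly when they
have a common restriction (`sigma_iff`), and each unit `R` is induced by the map on finite words
read off from `R` (`wordPEquiv`). -/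

/-! ### Aperiodic sequences and prefix replacement relations -/

/-- The sequences over `Fin n` no two distinct tails of which coincide. -/
def AperiodicSeq (n : ℕ) : Type :=
  {w : ℕ → Fin n // ∀ k l, (∀ i, w (i + k) = w (i + l)) → k = l}

namespace AperiodicSeq

variable {n : ℕ}

@[ext]
theorem ext {w w' : AperiodicSeq n} (h : ∀ i, w.1 i = w'.1 i) : w = w' :=
  Subtype.ext (funext h)

/-- The indicator sequence of the perfect squares is aperiodic, since the gaps between squares grow.
-/
theorem nonempty [Nontrivial (Fin n)] : Nonempty (AperiodicSeq n) := by
  classical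
  obtain ⟨a, b, hab⟩ := exists_pair_ne (Fin n)
  have key : ∀ k d, (∀ i, (if IsSquare (i + k) then a else b) =
      if IsSquare (i + (k + d)) then a else b) → d = 0 := by
    intro k d h
    by_contra hd
    -- At this index the first tail reads position `(k + d)²` and the second `(k + d)² + d`, which
    -- for `d > 0` lies strictly between consecutive squares.
    have h1 := h ((k + d) * (k + d) - k)
    have h2 : (k + d) * (k + d) - k + k = (k + d) * (k + d) :=
      Nat.sub_add_cancel (by nlinarith [Nat.pos_of_ne_zero hd])
    rw [← add_assoc, h2, if_pos ⟨_, rfl⟩] at h1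
    split_ifs at h1 with hs
    · obtain ⟨r, hr⟩ := hs
      have h3 : k + d < r := by
        by_contra hle
        push Not at hle
        nlinarith [Nat.mul_le_mul hle hle, Nat.pos_of_ne_zero hd]
      nlinarith [Nat.mul_le_mul h3 h3]
    · exact hab h1
  refine ⟨⟨fun i => if IsSquare i then a else b, fun k l h => ?_⟩⟩
  rcases le_total k l with hkl | hkl <;> obtain ⟨d, rfl⟩ := Nat.exists_eq_add_of_le hkl
  · simp [key k d h]
  · simp [key l d fun i => (h i).symm]

/-- Prepend a letter. -/
def cons (i : Fin n) (w : AperiodicSeq n) : AperiodicSeq n :=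
  ⟨fun j => Nat.casesOn j i w.1, fun k l h => w.2 k l fun j => by
    have := h (j + 1)
    simpa only [Nat.add_right_comm j 1] using this⟩

theorem cons_inj {i j : Fin n} {w w' : AperiodicSeq n} (h : cons i w = cons j w') :
    i = j ∧ w = w' := by
  have h' := fun k => congrFun (congrArg Subtype.val h) k
  exact ⟨h' 0, ext fun k => h' (k + 1)⟩

theorem exists_cons (w : AperiodicSeq n) : ∃ i w', w = cons i w' := by
  refine ⟨w.1 0, ⟨fun i => w.1 (i + 1), fun k l h => ?_⟩, ?_⟩
  · refine Nat.succ_injective (w.2 (k + 1) (l + 1) fun i => ?_)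
    simpa only [add_assoc] using h i
  · ext i
    cases i <;> rfl

/-- Prepend a word. -/
def app : List (Fin n) → AperiodicSeq n → AperiodicSeq n
  | [], w => w
  | i :: u, w => cons i (app u w)

@[simp] theorem app_nil (w : AperiodicSeq n) : app [] w = w := rfl

@[simp] theorem app_cons (i : Fin n) (u : List (Fin n)) (w : AperiodicSeq n) :
    app (i :: u) w = cons i (app u w) := rfl

theorem app_append (u v : List (Fin n)) (w : AperiodicSeq n) :
    app (u ++ v) w = app u (app v w) := by
  induction u with
  | nil => rfl
  | cons i u ih => rw [List.cons_append, app_cons, app_cons, ih]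

theorem app_injective (u : List (Fin n)) : Function.Injective (app u) := by
  induction u with
  | nil => exact fun _ _ h => h
  | cons i u ih => exact fun _ _ h => ih (cons_inj h).2

theorem app_compare {u v : List (Fin n)} {w w' : AperiodicSeq n} (h : app u w = app v w') :
    (∃ t, v = u ++ t ∧ w = app t w') ∨ ∃ t, u = v ++ t ∧ w' = app t w := by
  induction u generalizing v with
  | nil => exact Or.inl ⟨v, rfl, h⟩
  | cons i u ih =>
    cases v with
    | nil => exact Or.inr ⟨i :: u, rfl, h.symm⟩
    | cons j v =>
      obtain ⟨rfl, h'⟩ := cons_inj h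
      rcases ih h' with ⟨t, rfl, ht⟩ | ⟨t, rfl, ht⟩
      · exact Or.inl ⟨t, rfl, ht⟩
      · exact Or.inr ⟨t, rfl, ht⟩

theorem prefix_of_length_le {u v : List (Fin n)} {w w' : AperiodicSeq n}
    (h : app u w = app v w') (hl : v.length ≤ u.length) :
    ∃ t, u = v ++ t ∧ w' = app t w := by
  rcases app_compare h with ⟨t, rfl, ht'⟩ | h'
  · have ht : t = [] := by
      rw [List.length_append] at hl
      exact List.length_eq_zero_iff.1 (by omega)
    subst ht
    exact ⟨[], by simp, ht'.symm⟩
  · exact h'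

theorem app_val_add (u : List (Fin n)) (w : AperiodicSeq n) (i : ℕ) :
    (app u w).1 (i + u.length) = w.1 i := by
  induction u with
  | nil => rfl
  | cons j u ih => exact ih

theorem app_val_lt (u : List (Fin n)) (w w' : AperiodicSeq n) {i : ℕ} (hi : i < u.length) :
    (app u w).1 i = (app u w').1 i := by
  induction u generalizing i with
  | nil => simp at hi
  | cons j u ih =>
    cases i with
    | zero => rfl
    | succ i => exact ih (Nat.lt_of_succ_lt_succ hi)

/-- Words act freely on aperiodic sequences. -/
theorem app_free {u v : List (Fin n)} {w : AperiodicSeq n} (h : app u w = app v w) : u = v := by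
  have key : ∀ t : List (Fin n), w = app t w → t = [] := by
    intro t ht
    -- If `w = t w`, the tails of `w` starting at `t.length` and at `0` coincide.
    refine List.length_eq_zero_iff.1 (w.2 _ 0 fun i => ?_)
    conv_lhs => rw [ht]
    exact app_val_add t w i
  rcases app_compare h with ⟨t, rfl, ht⟩ | ⟨t, rfl, ht⟩ <;> simp [key t ht]

theorem exists_app (k : ℕ) (w : AperiodicSeq n) : ∃ u w', u.length = k ∧ w = app u w' := by
  induction k with
  | zero => exact ⟨[], w, rfl, rfl⟩
  | succ k ih =>
    obtain ⟨u, w', rfl, rfl⟩ := ih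
    obtain ⟨i, w', rfl⟩ := exists_cons w'
    exact ⟨u ++ [i], w', by simp, by rw [app_append]; rfl⟩

end AperiodicSeq

open AperiodicSeq

/-! ### Prefix replacement relations. -/

section Graph

variable {n : ℕ}

/-- The relation replacing the prefix `x` by `y`; pairs are written `(output, input)`. -/
def prefixRel (y x : List (Fin n)) : SetRel (AperiodicSeq n) (AperiodicSeq n) :=
  {r | ∃ w, r = (app y w, app x w)}

theorem mem_prefixRel {y x : List (Fin n)} {r : AperiodicSeq n × AperiodicSeq n} :
    r ∈ prefixRel y x ↔ ∃ w, r = (app y w, app x w) := Iff.rfl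

theorem mk_mem_prefixRel (y x : List (Fin n)) (w : AperiodicSeq n) :
    (app y w, app x w) ∈ prefixRel y x := ⟨w, rfl⟩

theorem prefixRel_append_subset (y x v : List (Fin n)) :
    prefixRel (y ++ v) (x ++ v) ⊆ prefixRel y x := by
  rintro _ ⟨w, rfl⟩
  exact ⟨app v w, by rw [app_append, app_append]⟩

/-- Comparing inputs makes one of `x`, `x'` extend the other by some `t`. The outputs then agree on
one sequence, and freeness forces `y`, `y'` to differ by the same `t`. This is the point of
aperiodicity. -/
theorem prefixRel_compare {y x y' x' : List (Fin n)} {r : AperiodicSeq n × AperiodicSeq n}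
    (h : r ∈ prefixRel y x) (h' : r ∈ prefixRel y' x') :
    (∃ v, y' = y ++ v ∧ x' = x ++ v) ∨ ∃ v, y = y' ++ v ∧ x = x' ++ v := by
  obtain ⟨w, rfl⟩ := h
  obtain ⟨w', h⟩ := h'
  obtain ⟨hy, hx⟩ := Prod.ext_iff.1 h
  simp only at hy hx
  rcases app_compare hx with ⟨t, rfl, rfl⟩ | ⟨t, rfl, rfl⟩
  · rw [← app_append] at hy
    exact Or.inl ⟨t, (app_free hy).symm, rfl⟩
  · rw [← app_append] at hy
    exact Or.inr ⟨t, app_free hy, rfl⟩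

theorem prefixRel_nonempty [Nontrivial (Fin n)] (y x : List (Fin n)) :
    (prefixRel y x).Nonempty := by
  obtain ⟨w⟩ := AperiodicSeq.nonempty (n := n)
  exact ⟨_, mk_mem_prefixRel y x w⟩

theorem exists_of_prefixRel_subset [Nontrivial (Fin n)] {y x y' x' : List (Fin n)}
    (h : prefixRel y x ⊆ prefixRel y' x') : ∃ v, y = y' ++ v ∧ x = x' ++ v := by
  obtain ⟨r, hr⟩ := prefixRel_nonempty y x
  rcases prefixRel_compare hr (h hr) with ⟨v, rfl, rfl⟩ | h'
  · cases v with
    | nil => exact ⟨[], by simp⟩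
    | cons i v =>
      -- In this case the target is a restriction to inputs continuing `x` by `i`; an input
      -- continuing `x` by another letter `j` escapes it.
      obtain ⟨j, hj⟩ := exists_ne i
      obtain ⟨w⟩ := AperiodicSeq.nonempty (n := n)
      obtain ⟨w', hw'⟩ := h (mk_mem_prefixRel y x (cons j w))
      have h1 := congrArg Prod.fst hw'
      simp only [app_append] at h1
      exact absurd (cons_inj (app_injective _ h1)).1 hj
  · exact h'

theorem prefixRel_injective [Nontrivial (Fin n)] {y x y' x' : List (Fin n)}
    (h : prefixRel y x = prefixRel y' x') : y = y' ∧ x = x' := by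
  obtain ⟨v, rfl, rfl⟩ := exists_of_prefixRel_subset h.le
  obtain ⟨v', h1, -⟩ := exists_of_prefixRel_subset h.ge
  have : v = [] := by
    have := congrArg List.length h1
    simp only [List.length_append] at this
    exact List.length_eq_zero_iff.1 (by omega)
  simp [this]

theorem comp_prefixRel_nil (y x : List (Fin n)) :
    (prefixRel y []).comp (prefixRel [] x) = prefixRel y x := by
  ext ⟨q, p⟩
  constructor
  · rintro ⟨_, ⟨w, h1⟩, ⟨w', h2⟩⟩
    simp only [Prod.mk.injEq, app_nil] at h1 h2
    exact ⟨w, by rw [h1.1, h2.2, ← h2.1, h1.2]⟩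
  · rintro ⟨w, h⟩
    obtain ⟨rfl, rfl⟩ := Prod.ext_iff.1 h
    exact ⟨w, ⟨w, rfl⟩, ⟨w, rfl⟩⟩

theorem inv_prefixRel (y x : List (Fin n)) : (prefixRel y x).inv = prefixRel x y := by
  ext ⟨q, p⟩
  simp only [SetRel.mem_inv, mem_prefixRel, Prod.mk.injEq, and_comm]

theorem prefixRel_nil_nil : prefixRel [] [] = (SetRel.id : SetRel (AperiodicSeq n) _) := by
  ext ⟨q, p⟩
  constructor
  · rintro ⟨w, h⟩
    simp only [Prod.mk.injEq, app_nil] at h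
    exact h.1.trans h.2.symm
  · intro h
    obtain rfl : q = p := h
    exact ⟨q, rfl⟩

/-- A relation relating at most one output to each input, and conversely. -/
def IsPartialInj {X : Type*} (R : SetRel X X) : Prop :=
  (∀ q q' p, (q, p) ∈ R → (q', p) ∈ R → q = q') ∧ ∀ q p p', (q, p) ∈ R → (q, p') ∈ R → p = p'

theorem IsPartialInj.mono {X : Type*} {R R' : SetRel X X} (h : IsPartialInj R') (hR : R ⊆ R') :
    IsPartialInj R :=
  ⟨fun q q' p h1 h2 => h.1 q q' p (hR h1) (hR h2), fun q p p' h1 h2 => h.2 q p p' (hR h1) (hR h2)⟩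

theorem isPartialInj_prefixRel (y x : List (Fin n)) : IsPartialInj (prefixRel y x) := by
  constructor
  · rintro q q' p ⟨w, h⟩ ⟨w', h'⟩
    simp only [Prod.mk.injEq] at h h'
    rw [h.1, h'.1, app_injective x (h.2.symm.trans h'.2)]
  · rintro q p p' ⟨w, h⟩ ⟨w', h'⟩
    simp only [Prod.mk.injEq] at h h'
    rw [h.2, h'.2, app_injective y (h.1.symm.trans h'.1)]

/-- Finite unions of prefix replacement relations. -/
inductive IsPrefixUnion : SetRel (AperiodicSeq n) (AperiodicSeq n) → Prop
  | empty : IsPrefixUnion ∅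
  | basic (y x : List (Fin n)) : IsPrefixUnion (prefixRel y x)
  | union {R R' : SetRel (AperiodicSeq n) (AperiodicSeq n)} :
    IsPrefixUnion R → IsPrefixUnion R' → IsPrefixUnion (R ∪ R')

/-! ### Boolean operations on finite unions, and their closedness. -/

namespace IsPrefixUnion

variable {R R' : SetRel (AperiodicSeq n) (AperiodicSeq n)}

theorem biUnion {ι : Type*} {s : Set ι} (hs : s.Finite)
    {f : ι → SetRel (AperiodicSeq n) (AperiodicSeq n)} (h : ∀ i ∈ s, IsPrefixUnion (f i)) :
    IsPrefixUnion (⋃ i ∈ s, f i) := by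
  induction s, hs using Set.Finite.induction_on with
  | empty => simpa using IsPrefixUnion.empty
  | insert _ _ ih =>
    rw [Set.biUnion_insert]
    exact (h _ (Set.mem_insert _ _)).union (ih fun i hi => h i (Set.mem_insert_of_mem _ hi))

theorem prefixRel_inter (y x y' x' : List (Fin n)) :
    IsPrefixUnion (prefixRel y x ∩ prefixRel y' x') := by
  rcases Set.eq_empty_or_nonempty (prefixRel y x ∩ prefixRel y' x') with h | ⟨r, h, h'⟩
  · rw [h]
    exact empty
  · rcases prefixRel_compare h h' with ⟨v, rfl, rfl⟩ | ⟨v, rfl, rfl⟩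
    · rw [Set.inter_eq_right.2 (prefixRel_append_subset _ _ _)]
      exact basic _ _
    · rw [Set.inter_eq_left.2 (prefixRel_append_subset _ _ _)]
      exact basic _ _

theorem inter (h : IsPrefixUnion R) (h' : IsPrefixUnion R') : IsPrefixUnion (R ∩ R') := by
  induction h with
  | empty => simpa using empty
  | basic y x =>
    induction h' with
    | empty => simpa using empty
    | basic y' x' => exact prefixRel_inter y x y' x'
    | union _ _ h1 h2 => rw [Set.inter_union_distrib_left]; exact h1.union h2
  | union _ _ h1 h2 => rw [Set.union_inter_distrib_right]; exact h1.union h2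

/-- Removing the piece along `v` leaves the pieces along the other words of the same length as `v`,
of which there are finitely many. -/
theorem prefixRel_diff (y x y' x' : List (Fin n)) :
    IsPrefixUnion (prefixRel y x \ prefixRel y' x') := by
  rcases Set.eq_empty_or_nonempty (prefixRel y x ∩ prefixRel y' x') with h | ⟨r, h, h'⟩
  · rw [(Set.disjoint_iff_inter_eq_empty.2 h).sdiff_eq_left]
    exact basic _ _
  · rcases prefixRel_compare h h' with ⟨v, rfl, rfl⟩ | ⟨v, rfl, rfl⟩
    · have key : prefixRel y x \ prefixRel (y ++ v) (x ++ v) =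
          ⋃ t ∈ {t : List (Fin n) | t.length = v.length ∧ t ≠ v},
            prefixRel (y ++ t) (x ++ t) := by
        ext r
        simp only [Set.mem_iUnion]
        constructor
        · rintro ⟨⟨w, rfl⟩, hr⟩
          obtain ⟨t, w, ht, rfl⟩ := exists_app v.length w
          have hmem : (app y (app t w), app x (app t w)) ∈ prefixRel (y ++ t) (x ++ t) :=
            ⟨w, by rw [app_append, app_append]⟩
          refine ⟨t, ⟨ht, ?_⟩, hmem⟩
          rintro rfl
          exact hr hmem
        · rintro ⟨t, ⟨ht, htv⟩, hr⟩
          refine ⟨prefixRel_append_subset _ _ _ hr, fun hr' => htv ?_⟩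
          -- Words of equal length are prefix-comparable only if they are equal.
          rcases prefixRel_compare hr hr' with ⟨s, hs, -⟩ | ⟨s, hs, -⟩
          · rw [List.append_assoc] at hs
            exact (List.append_inj_left' (s₁ := v) (t₁ := []) (by simpa using hs)
              (by have := congrArg List.length hs; simp at this ⊢; omega)).symm
          · rw [List.append_assoc] at hs
            exact (List.append_inj_left' (s₁ := t) (t₁ := []) (by simpa using hs)
              (by have := congrArg List.length hs; simp at this ⊢; omega))
      rw [key]
      exact biUnion ((List.finite_length_eq (Fin n) v.length).subset fun t ht => ht.1)
        fun t _ => basic _ _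
    · rw [Set.sdiff_eq_empty.2 (prefixRel_append_subset _ _ _)]
      exact empty

theorem diff (h : IsPrefixUnion R) (h' : IsPrefixUnion R') : IsPrefixUnion (R \ R') := by
  induction h with
  | empty => simpa using empty
  | basic y x =>
    induction h' with
    | empty => simpa using basic y x
    | basic y' x' => exact prefixRel_diff y x y' x'
    | union _ _ h1 h2 => rw [← Set.sdiff_inter_sdiff]; exact h1.inter h2
  | union _ _ h1 h2 => rw [Set.union_sdiff_distrib]; exact h1.union h2

/-- A finite union of prefix replacement relations is closed for the product topology. -/
theorem exists_separating (h : IsPrefixUnion R) {q p : AperiodicSeq n} (hqp : (q, p) ∉ R) :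
    ∃ N : ℕ, ∀ u v q' p', N ≤ u.length → N ≤ v.length → q = app u q' → p = app v p' →
      ∀ w w', (app u w, app v w') ∉ R := by
  induction h with
  | empty => exact ⟨0, fun _ _ _ _ _ _ _ _ _ _ h => h⟩
  | union _ _ h1 h2 =>
    obtain ⟨N₁, h1⟩ := h1 fun h => hqp (Or.inl h)
    obtain ⟨N₂, h2⟩ := h2 fun h => hqp (Or.inr h)
    refine ⟨max N₁ N₂, fun u v q' p' hu hv hq hp w w' h => ?_⟩
    rcases h with h | h
    · exact h1 u v q' p' (le_of_max_le_left hu) (le_of_max_le_left hv) hq hp w w' h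
    · exact h2 u v q' p' (le_of_max_le_right hu) (le_of_max_le_right hv) hq hp w w' h
  | basic y x =>
    -- If `q`, `p` begin with `y`, `x`, the remainders differ at some `i`, and `N = i + 1` keeps
    -- that letter visible. Otherwise `N = 0` works vacuously.
    have hsep : ∃ N : ℕ, ∀ t t', q = app y t → p = app x t' → ∃ i < N, t.1 i ≠ t'.1 i := by
      by_cases hex : ∃ t t', q = app y t ∧ p = app x t'
      · obtain ⟨t, t', rfl, rfl⟩ := hex
        have hne : t ≠ t' := by
          rintro rfl
          exact hqp ⟨t, rfl⟩
        obtain ⟨i, hi⟩ : ∃ i, t.1 i ≠ t'.1 i := by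
          by_contra! hi
          exact hne (AperiodicSeq.ext hi)
        refine ⟨i + 1, fun s s' hs hs' => ⟨i, Nat.lt_succ_self i, ?_⟩⟩
        rwa [← app_injective _ hs, ← app_injective _ hs']
      · exact ⟨0, fun t t' h1 h2 => absurd ⟨t, t', h1, h2⟩ hex⟩
    obtain ⟨N, hN⟩ := hsep
    -- Long enough for `u` and `v` to swallow `y` and `x` and still show the next `N` letters of
    -- both remainders.
    refine ⟨max y.length x.length + N, ?_⟩
    rintro u v q' p' hu hv rfl rfl w w' ⟨r, hr⟩
    obtain ⟨h1, h2⟩ := Prod.ext_iff.1 hr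
    obtain ⟨s, rfl, hs⟩ := prefix_of_length_le h1 (by omega)
    obtain ⟨s', rfl, hs'⟩ := prefix_of_length_le h2 (by omega)
    obtain ⟨i, hi, hne⟩ := hN (app s q') (app s' p') (app_append _ _ _) (app_append _ _ _)
    rw [List.length_append] at hu hv
    apply hne
    rw [app_val_lt s q' w (by omega), app_val_lt s' p' w' (by omega), ← hs, ← hs']

end IsPrefixUnion

end Graph

/-! ### Faithful representations by partial injections -/

open InverseSemigroup

theorem Semigroup.map_inverse {S T : Type*} [SemigroupWithZero S] [InverseSemigroup S]
    [SemigroupWithZero T] [InverseSemigroup T] (θ : S →ₙ* T) (a : S) : θ a⁻¹ = (θ a)⁻¹ :=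
  inv_unique _ _ (by rw [← map_mul, ← map_mul, mul_inv_mul])
    (by rw [← map_mul, ← map_mul, inv_mul_inv])

theorem NatLE.map {S T : Type*} [SemigroupWithZero S] [InverseSemigroup S]
    [SemigroupWithZero T] [InverseSemigroup T] (θ : S →ₙ* T) {a b : S} (h : NatLE a b) :
    NatLE (θ a) (θ b) := by
  unfold NatLE
  rw [← Semigroup.map_inverse, ← map_mul, ← map_mul, ← h]

theorem Compatible.map {S T : Type*} [SemigroupWithZero S] [InverseSemigroup S]
    [SemigroupWithZero T] [InverseSemigroup T] (θ : S →ₙ* T) {a b : S} (h : Compatible a b) :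
    Compatible (θ a) (θ b) := by
  constructor
  · rw [← Semigroup.map_inverse, ← map_mul]
    exact h.1.map θ
  · rw [← Semigroup.map_inverse, ← map_mul]
    exact h.2.map θ

theorem NatLE.antisymm {S : Type*} [SemigroupWithZero S] [InverseSemigroup S] {a b : S}
    (h : NatLE a b) (h' : NatLE b a) : a = b := by
  have h1 : a = b * (a⁻¹ * a) := h
  have h2 : b = a * (b⁻¹ * b) := h'
  calc a = b * (a⁻¹ * a) := h1
    _ = (a * (b⁻¹ * b)) * (a⁻¹ * a) := by rw [← h2]
    _ = a * ((b⁻¹ * b) * (a⁻¹ * a)) := mul_assoc _ _ _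
    _ = a * ((a⁻¹ * a) * (b⁻¹ * b)) := by rw [idem_comm (idem_inv_mul a) (idem_inv_mul b)]
    _ = (a * a⁻¹ * a) * (b⁻¹ * b) := by simp only [mul_assoc]
    _ = b := by rw [mul_inv_mul, ← h2]

theorem IsJoinOf.unique {S : Type*} [SemigroupWithZero S] [InverseSemigroup S] {j j' : S}
    {X : Set S} (h : IsJoinOf j X) (h' : IsJoinOf j' X) : j = j' :=
  NatLE.antisymm (h.2 _ h'.1) (h'.2 _ h.1)

/-- A faithful representation of an inverse semigroup by partial injections. -/
structure IsFaithfulRep {S X : Type*} [SemigroupWithZero S] [InverseSemigroup S]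
    (φ : S → SetRel X X) : Prop where
  injective : Function.Injective φ
  map_mul : ∀ a b, φ (a * b) = (φ a).comp (φ b)
  map_zero : φ 0 = ∅
  isPartialInj : ∀ a, IsPartialInj (φ a)

namespace IsFaithfulRep

variable {S X : Type*} [SemigroupWithZero S] [InverseSemigroup S] {φ : S → SetRel X X}

theorem mem_mul (hφ : IsFaithfulRep φ) {a b : S} {q p : X} :
    (q, p) ∈ φ (a * b) ↔ ∃ m, (q, m) ∈ φ a ∧ (m, p) ∈ φ b := by
  rw [hφ.map_mul]
  exact Iff.rfl

/-- Compatibility with inverses need not be assumed: a pair in `φ (a⁻¹ * a * a⁻¹)` passes through `φ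
a`, and injectivity of `φ a⁻¹` in both directions identifies the intermediate points. -/
theorem mem_inv (hφ : IsFaithfulRep φ) {a : S} {q p : X} :
    (q, p) ∈ φ a⁻¹ ↔ (p, q) ∈ φ a := by
  have key : ∀ (a : S) (q p : X), (q, p) ∈ φ a⁻¹ → (p, q) ∈ φ a := by
    intro a q p h
    have h' := h
    rw [← inv_mul_inv, hφ.mem_mul] at h'
    obtain ⟨b, h', h3⟩ := h'
    obtain ⟨c, h1, h2⟩ := hφ.mem_mul.1 h'
    rw [(hφ.isPartialInj _).1 _ _ _ h h3, (hφ.isPartialInj _).2 _ _ _ h h1]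
    exact h2
  refine ⟨key a q p, fun h => key a⁻¹ p q ?_⟩
  rwa [inv_inv']

/-- `b * (a⁻¹ * a)` is the restriction of `b` to the domain of `a`. -/
theorem natLE_iff (hφ : IsFaithfulRep φ) {a b : S} : NatLE a b ↔ φ a ⊆ φ b := by
  constructor
  · rintro h ⟨q, p⟩ hqp
    rw [h] at hqp
    obtain ⟨m, h1, h2⟩ := hφ.mem_mul.1 hqp
    obtain ⟨k, h2, h3⟩ := hφ.mem_mul.1 h2
    rwa [← (hφ.isPartialInj a).2 _ _ _ (hφ.mem_inv.1 h2) h3]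
  · intro h
    apply hφ.injective
    ext ⟨q, p⟩
    simp only [hφ.mem_mul, hφ.mem_inv]
    constructor
    · exact fun hqp => ⟨p, h hqp, q, hqp, hqp⟩
    · rintro ⟨m, h1, k, h2, h3⟩
      rwa [(hφ.isPartialInj b).1 _ _ _ h1 (h h2)]

theorem isIdempotentElem_iff (hφ : IsFaithfulRep φ) {e : S} :
    IsIdempotentElem e ↔ φ e ⊆ SetRel.id := by
  constructor
  · rintro h ⟨q, p⟩ hqp
    have h' := hqp
    rw [← h.eq] at h'
    obtain ⟨m, h1, h2⟩ := hφ.mem_mul.1 h'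
    rw [(hφ.isPartialInj e).2 _ _ _ h1 hqp] at h2 h1
    exact (hφ.isPartialInj e).1 _ _ _ hqp h2
  · intro h
    apply hφ.injective
    ext ⟨q, p⟩
    rw [hφ.mem_mul]
    constructor
    · rintro ⟨m, h1, h2⟩
      obtain rfl : q = m := h h1
      exact h2
    · intro hqp
      obtain rfl : q = p := h hqp
      exact ⟨q, hqp, hqp⟩

/-- Idempotents are partial identities. For `s⁻¹ * t` this says that equal outputs of `s` and `t`
come from equal inputs, for `s * t⁻¹` that equal inputs have equal outputs. -/
theorem compatible_iff (hφ : IsFaithfulRep φ) {s t : S} :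
    Compatible s t ↔ IsPartialInj (φ s ∪ φ t) := by
  unfold Compatible
  rw [hφ.isIdempotentElem_iff, hφ.isIdempotentElem_iff]
  constructor
  · rintro ⟨h1, h2⟩
    have h1' : ∀ m a b, (m, a) ∈ φ s → (m, b) ∈ φ t → a = b := fun m a b ha hb =>
      @h1 (a, b) (hφ.mem_mul.2 ⟨m, hφ.mem_inv.2 ha, hb⟩)
    have h2' : ∀ m a b, (a, m) ∈ φ s → (b, m) ∈ φ t → a = b := fun m a b ha hb =>
      @h2 (a, b) (hφ.mem_mul.2 ⟨m, ha, hφ.mem_inv.2 hb⟩)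
    constructor
    · rintro q q' p (h | h) (h' | h')
      · exact (hφ.isPartialInj s).1 _ _ _ h h'
      · exact h2' _ _ _ h h'
      · exact (h2' _ _ _ h' h).symm
      · exact (hφ.isPartialInj t).1 _ _ _ h h'
    · rintro q p p' (h | h) (h' | h')
      · exact (hφ.isPartialInj s).2 _ _ _ h h'
      · exact h1' _ _ _ h h'
      · exact (h1' _ _ _ h' h).symm
      · exact (hφ.isPartialInj t).2 _ _ _ h h'
  · intro h
    constructor
    · rintro ⟨a, b⟩ hab
      obtain ⟨m, ha, hb⟩ := hφ.mem_mul.1 hab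
      exact h.2 m a b (Or.inl (hφ.mem_inv.1 ha)) (Or.inr hb)
    · rintro ⟨a, b⟩ hab
      obtain ⟨m, ha, hb⟩ := hφ.mem_mul.1 hab
      exact h.1 a b m (Or.inl ha) (Or.inr (hφ.mem_inv.1 hb))

/-- Being a partial injection is tested on two pairs at a time, so pairwise compatibility suffices.
-/
theorem compatibleSet_iff (hφ : IsFaithfulRep φ) {A : Set S} :
    CompatibleSet A ↔ IsPartialInj (⋃ a ∈ A, φ a) := by
  constructor
  · intro h
    constructor
    · intro q q' p hq hq'
      simp only [Set.mem_iUnion] at hq hq'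
      obtain ⟨s, hs, hq⟩ := hq
      obtain ⟨t, ht, hq'⟩ := hq'
      exact (hφ.compatible_iff.1 (h s hs t ht)).1 q q' p (Or.inl hq) (Or.inr hq')
    · intro q q' p hq hq'
      simp only [Set.mem_iUnion] at hq hq'
      obtain ⟨s, hs, hq⟩ := hq
      obtain ⟨t, ht, hq'⟩ := hq'
      exact (hφ.compatible_iff.1 (h s hs t ht)).2 q q' p (Or.inl hq) (Or.inr hq')
  · intro h s hs t ht
    exact hφ.compatible_iff.2 (h.mono (Set.union_subset
      (Set.subset_biUnion_of_mem (u := φ) hs) (Set.subset_biUnion_of_mem (u := φ) ht)))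

/-- The converse needs the union itself to be represented; see
`IsPrefixUnionRep.eq_biUnion_of_isJoinOf`. -/
theorem isJoinOf_of_eq (hφ : IsFaithfulRep φ) {j : S} {A : Set S} (h : φ j = ⋃ a ∈ A, φ a) :
    IsJoinOf j A :=
  ⟨fun _ ha => hφ.natLE_iff.2 (h ▸ Set.subset_biUnion_of_mem (u := φ) ha), fun _ hc =>
    hφ.natLE_iff.2 (h ▸ Set.iUnion₂_subset fun a ha => hφ.natLE_iff.1 (hc a ha))⟩

theorem biUnion_lowerSet (hφ : IsFaithfulRep φ) (A : Set S) :
    ⋃ a ∈ lowerSet A, φ a = ⋃ a ∈ A, φ a := by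
  apply Set.Subset.antisymm
  · refine Set.iUnion₂_subset ?_
    rintro b ⟨a, ha, hba⟩
    exact (hφ.natLE_iff.1 hba).trans (Set.subset_biUnion_of_mem (u := φ) ha)
  · exact Set.biUnion_subset_biUnion_left fun a ha => ⟨a, ha, natLE_refl a⟩

theorem isMeetOf_of_eq (hφ : IsFaithfulRep φ) {m a b : S} (h : φ m = φ a ∩ φ b) :
    IsMeetOf m a b :=
  ⟨hφ.natLE_iff.2 (h ▸ Set.inter_subset_left), hφ.natLE_iff.2 (h ▸ Set.inter_subset_right),
    fun _ ha hb => hφ.natLE_iff.2 (h ▸ Set.subset_inter (hφ.natLE_iff.1 ha) (hφ.natLE_iff.1 hb))⟩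

end IsFaithfulRep

/-- A faithful representation whose nonzero values are the prefix replacement relations. -/
structure IsPrefixRep {n : ℕ} {S : Type*} [SemigroupWithZero S] [InverseSemigroup S]
    (φ : S → SetRel (AperiodicSeq n) (AperiodicSeq n)) : Prop extends IsFaithfulRep φ where
  eq_zero_or : ∀ s, s = 0 ∨ ∃ y x, φ s = prefixRel y x
  exists_eq : ∀ y x, ∃ s, φ s = prefixRel y x

/-- A faithful representation whose values are the finite unions of prefix replacement relations
that are partial injections. -/
structure IsPrefixUnionRep {n : ℕ} {D : Type*} [SemigroupWithZero D] [InverseSemigroup D]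
    (Φ : D → SetRel (AperiodicSeq n) (AperiodicSeq n)) : Prop extends IsFaithfulRep Φ where
  isPrefixUnion : ∀ d, IsPrefixUnion (Φ d)
  exists_eq : ∀ R, IsPrefixUnion R → IsPartialInj R → ∃ d, Φ d = R

/-! ### The Lenz arrow as inclusion of relations. -/

namespace IsPrefixRep

variable {n : ℕ} {S : Type*} [SemigroupWithZero S] [InverseSemigroup S]
  {φ : S → SetRel (AperiodicSeq n) (AperiodicSeq n)}

theorem isPrefixUnion (hφ : IsPrefixRep φ) (s : S) : IsPrefixUnion (φ s) := by
  rcases hφ.eq_zero_or s with rfl | ⟨y, x, h⟩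
  · rw [hφ.map_zero]
    exact .empty
  · rw [h]
    exact .basic y x

theorem nonempty_of_ne_zero [Nontrivial (Fin n)] (hφ : IsPrefixRep φ) {s : S} (hs : s ≠ 0) :
    (φ s).Nonempty := by
  obtain ⟨y, x, h⟩ := (hφ.eq_zero_or s).resolve_left hs
  exact h ▸ prefixRel_nonempty y x

theorem exists_finite_eq (hφ : IsPrefixRep φ) {R : SetRel (AperiodicSeq n) (AperiodicSeq n)}
    (hR : IsPrefixUnion R) : ∃ F : Set S, F.Finite ∧ R = ⋃ s ∈ F, φ s := by
  induction hR with
  | empty => exact ⟨∅, Set.finite_empty, by simp⟩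
  | basic y x =>
    obtain ⟨s, hs⟩ := hφ.exists_eq y x
    exact ⟨{s}, Set.finite_singleton s, by simp [hs]⟩
  | union _ _ h1 h2 =>
    obtain ⟨F, hF, rfl⟩ := h1
    obtain ⟨G, hG, rfl⟩ := h2
    exact ⟨F ∪ G, hF.union hG, by rw [Set.biUnion_union]⟩

/-- Adjoining `0` changes no union, and distributivity is available only for nonempty families. -/
theorem exists_finite_nonempty_eq (hφ : IsPrefixRep φ)
    {R : SetRel (AperiodicSeq n) (AperiodicSeq n)} (hR : IsPrefixUnion R) :
    ∃ F : Set S, F.Finite ∧ F.Nonempty ∧ R = ⋃ s ∈ F, φ s := by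
  obtain ⟨F, hF, rfl⟩ := hφ.exists_finite_eq hR
  exact ⟨insert 0 F, hF.insert 0, Set.insert_nonempty 0 F, by
    rw [Set.biUnion_insert, hφ.map_zero, Set.empty_union]⟩

theorem natLE_or_natLE (hφ : IsPrefixRep φ) {s t : S} (h : (φ s ∩ φ t).Nonempty) :
    NatLE s t ∨ NatLE t s := by
  obtain ⟨r, hs, ht⟩ := h
  rcases hφ.eq_zero_or s with rfl | ⟨y, x, h⟩
  · exact Or.inl (zero_natLE t)
  rcases hφ.eq_zero_or t with rfl | ⟨y', x', h'⟩
  · exact Or.inr (zero_natLE s)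
  rw [hφ.natLE_iff, hφ.natLE_iff, h, h']
  rcases prefixRel_compare (h ▸ hs) (h' ▸ ht) with ⟨v, rfl, rfl⟩ | ⟨v, rfl, rfl⟩
  · exact Or.inr (prefixRel_append_subset _ _ _)
  · exact Or.inl (prefixRel_append_subset _ _ _)

theorem exists_inter (hφ : IsPrefixRep φ) (s t : S) : ∃ m, φ m = φ s ∩ φ t := by
  rcases Set.eq_empty_or_nonempty (φ s ∩ φ t) with h | h
  · exact ⟨0, by rw [h, hφ.map_zero]⟩
  · rcases hφ.natLE_or_natLE h with h | h
    · exact ⟨s, (Set.inter_eq_left.2 (hφ.natLE_iff.1 h)).symm⟩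
    · exact ⟨t, (Set.inter_eq_right.2 (hφ.natLE_iff.1 h)).symm⟩

theorem isInverseMeetSemigroup (hφ : IsPrefixRep φ) : IsInverseMeetSemigroup S := fun a b =>
  (hφ.exists_inter a b).imp fun _ h => hφ.isMeetOf_of_eq h

/-- A point of `x` lies in some `b`; overlapping elements are comparable, so the smaller of `x` and
`b` is a nonzero common lower bound. -/
theorem lenzArrow_of_subset [Nontrivial (Fin n)] (hφ : IsPrefixRep φ) {A B : Set S}
    (h : ∀ a ∈ A, φ a ⊆ ⋃ b ∈ B, φ b) : LenzArrow A B := by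
  intro a ha x hx hxa
  obtain ⟨r, hr⟩ := hφ.nonempty_of_ne_zero hx
  have hr' := h a ha (hφ.natLE_iff.1 hxa hr)
  simp only [Set.mem_iUnion] at hr'
  obtain ⟨b, hb, hrb⟩ := hr'
  refine ⟨b, hb, ?_⟩
  rcases hφ.natLE_or_natLE ⟨r, hr, hrb⟩ with h' | h'
  · exact ⟨x, hx, natLE_refl x, h'⟩
  · refine ⟨b, ?_, h', natLE_refl b⟩
    rintro rfl
    simp [hφ.map_zero] at hrb

/-- A point of `a` outside the union over `B`, which is closed because `B` is finite, would have a
nonzero `z` below `a` around it that misses this union. The arrow yields a nonzero element below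
both `z` and some `b`, a contradiction. -/
theorem subset_of_lenzArrow [Nontrivial (Fin n)] (hφ : IsPrefixRep φ) {A B : Set S}
    (hB : B.Finite) (h : LenzArrow A B) {a : S} (ha : a ∈ A) : φ a ⊆ ⋃ b ∈ B, φ b := by
  intro r hr
  by_contra hrB
  rcases hφ.eq_zero_or a with rfl | ⟨y, x, hyx⟩
  · simp [hφ.map_zero] at hr
  rw [hyx] at hr
  obtain ⟨w, rfl⟩ := hr
  obtain ⟨N, hN⟩ := (IsPrefixUnion.biUnion hB fun b _ => hφ.isPrefixUnion b).exists_separating hrB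
  obtain ⟨u, w, rfl, rfl⟩ := exists_app N w
  -- `z` restricts `a` along the next `N` letters, so all its points share with the chosen one
  -- prefixes long enough for `hN`.
  obtain ⟨z, hz⟩ := hφ.exists_eq (y ++ u) (x ++ u)
  have hza : NatLE z a := by
    rw [hφ.natLE_iff, hz, hyx]
    exact prefixRel_append_subset _ _ _
  have hz0 : z ≠ 0 := by
    rintro rfl
    rw [hφ.map_zero] at hz
    exact (prefixRel_nonempty (y ++ u) (x ++ u)).ne_empty hz.symm
  obtain ⟨b, hb, c, hc, hcz, hcb⟩ := h a ha z hz0 hza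
  obtain ⟨r, hr⟩ := hφ.nonempty_of_ne_zero hc
  have hrz := hφ.natLE_iff.1 hcz hr
  rw [hz] at hrz
  obtain ⟨t, rfl⟩ := hrz
  refine hN (y ++ u) (x ++ u) w w (by simp) (by simp) (app_append _ _ _).symm
    (app_append _ _ _).symm t t ?_
  simp only [Set.mem_iUnion]
  exact ⟨b, hb, hφ.natLE_iff.1 hcb hr⟩

/-- So the passage to the quotient by `↔` identifies nothing, and `φ` descends to it. -/
theorem eq_of_lenzArrow [Nontrivial (Fin n)] (hφ : IsPrefixRep φ) {a b : S}
    (h : LenzArrow {a} {b}) (h' : LenzArrow {b} {a}) : a = b := by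
  apply hφ.injective
  apply Set.Subset.antisymm
  · simpa using hφ.subset_of_lenzArrow (Set.finite_singleton b) h rfl
  · simpa using hφ.subset_of_lenzArrow (Set.finite_singleton a) h' rfl

end IsPrefixRep

/-! ### The representations of the polycyclic monoid and of its completion -/

/-- Relations on `X`, as a monoid with zero under composition. -/
def RelMonoid (X : Type*) : Type _ := SetRel X X

namespace RelMonoid

instance (X : Type*) : MonoidWithZero (RelMonoid X) where
  mul R R' := SetRel.comp R R'
  one := SetRel.id
  zero := (∅ : Set (X × X))
  mul_assoc R R' R'' := SetRel.comp_assoc (R : SetRel X X) R' R''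
  one_mul R := SetRel.id_comp (R : SetRel X X)
  mul_one R := SetRel.comp_id (R : SetRel X X)
  zero_mul R := SetRel.empty_comp (R : SetRel X X)
  mul_zero R := SetRel.comp_empty (R : SetRel X X)

end RelMonoid

namespace Polycyclic

variable {n : ℕ}

/-- The representation of words by prefix replacement. -/
def wordRep (n : ℕ) : WithZero (FreeMonoid (Fin n ⊕ Fin n)) →*₀ RelMonoid (AperiodicSeq n) :=
  WithZero.lift' (FreeMonoid.lift (Sum.elim (fun i => prefixRel [i] []) fun i => prefixRel [] [i]))

theorem prefixRel_cancel (i : Fin n) :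
    (prefixRel [] [i]).comp (prefixRel [i] []) = SetRel.id := by
  ext ⟨q, p⟩
  constructor
  · rintro ⟨_, ⟨w, h1⟩, ⟨w', h2⟩⟩
    simp only [Prod.mk.injEq, app_nil] at h1 h2
    change q = p
    rw [h1.1, h2.2]
    exact (cons_inj (h1.2.symm.trans h2.1)).2
  · intro h
    obtain rfl : q = p := h
    exact ⟨app [i] q, ⟨q, rfl⟩, ⟨q, rfl⟩⟩

theorem prefixRel_ortho {i j : Fin n} (h : i ≠ j) :
    (prefixRel [] [i]).comp (prefixRel [j] []) = ∅ := by
  refine Set.eq_empty_of_forall_notMem ?_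
  rintro ⟨q, p⟩ ⟨_, ⟨w, h1⟩, ⟨w', h2⟩⟩
  simp only [Prod.mk.injEq, app_nil] at h1 h2
  exact h (cons_inj (h1.2.symm.trans h2.1)).1

theorem wordRep_le (n : ℕ) :
    conGen (PolycyclicRel n) ≤ Con.ker (wordRep n).toMonoidHom := by
  rw [Con.conGen_le]
  intro a b h
  change wordRep n a = wordRep n b
  cases h with
  | cancel i =>
    rw [map_one, wordRep, WithZero.lift'_coe]
    simp only [map_mul, FreeMonoid.lift_eval_of]
    exact prefixRel_cancel i
  | ortho i j h =>
    rw [map_zero, wordRep, WithZero.lift'_coe]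
    simp only [map_mul, FreeMonoid.lift_eval_of]
    exact prefixRel_ortho h

/-- The representation of the polycyclic monoid by prefix replacement, as a homomorphism. -/
def repHom (n : ℕ) : Polycyclic n →* RelMonoid (AperiodicSeq n) :=
  (conGen (PolycyclicRel n)).lift _ (wordRep_le n)

/-- The representation of the polycyclic monoid by prefix replacement. -/
def rep (s : Polycyclic n) : SetRel (AperiodicSeq n) (AperiodicSeq n) := repHom n s

theorem rep_mul (s t : Polycyclic n) : rep (s * t) = (rep s).comp (rep t) :=
  map_mul (repHom n) s t

theorem rep_one : rep (1 : Polycyclic n) = SetRel.id := map_one (repHom n)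

theorem rep_zero : rep (0 : Polycyclic n) = ∅ := map_zero (wordRep n)

theorem rep_letter (x : Fin n ⊕ Fin n) :
    rep (letter x) = Sum.elim (fun i => prefixRel [i] []) (fun i => prefixRel [] [i]) x := by
  change wordRep n ((FreeMonoid.of x : FreeMonoid (Fin n ⊕ Fin n)) :
    WithZero (FreeMonoid (Fin n ⊕ Fin n))) = _
  rw [wordRep, WithZero.lift'_coe, FreeMonoid.lift_eval_of]
  rfl

theorem rep_pos (y : List (Fin n)) : rep (pos y) = prefixRel y [] := by
  induction y with
  | nil => rw [pos_nil, rep_one, prefixRel_nil_nil]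
  | cons i y ih =>
    rw [pos_cons, rep_mul, ih, rep_letter]
    ext ⟨q, p⟩
    constructor
    · rintro ⟨_, ⟨w, h1⟩, ⟨w', h2⟩⟩
      simp only [Prod.mk.injEq, app_nil] at h1 h2
      exact ⟨w', by rw [h1.1, ← h1.2, h2.1, h2.2]; rfl⟩
    · rintro ⟨w, h⟩
      simp only [Prod.mk.injEq, app_nil] at h
      exact ⟨app y w, ⟨app y w, by rw [h.1]; rfl⟩, ⟨w, by rw [h.2]; rfl⟩⟩

theorem rep_pos_inv (x : List (Fin n)) : rep (pos x)⁻¹ = prefixRel [] x := by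
  induction x with
  | nil => rw [pos_nil, inv_one', rep_one, prefixRel_nil_nil]
  | cons i x ih =>
    rw [pos_cons, inv_mul_rev, rep_mul, ih, letter_inv, rep_letter]
    ext ⟨q, p⟩
    constructor
    · rintro ⟨_, ⟨w, h1⟩, ⟨w', h2⟩⟩
      simp only [Prod.mk.injEq, app_nil] at h1 h2
      exact ⟨w, by rw [h1.1, h2.2, ← h2.1, h1.2]; rfl⟩
    · rintro ⟨w, h⟩
      simp only [Prod.mk.injEq, app_nil] at h
      exact ⟨app x w, ⟨w, by rw [h.1]; rfl⟩, ⟨app x w, by rw [h.2]; rfl⟩⟩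

theorem rep_normal (y x : List (Fin n)) : rep (pos y * (pos x)⁻¹) = prefixRel y x := by
  rw [rep_mul, rep_pos, rep_pos_inv, comp_prefixRel_nil]

/-- Normal forms exist by rewriting; their uniqueness is not proved syntactically but follows from
`prefixRel_injective`, and with it the faithfulness of the representation. -/
theorem isPrefixRep [Nontrivial (Fin n)] : IsPrefixRep (rep (n := n)) where
  injective s t h := by
    rcases normalForm s with rfl | ⟨y, x, rfl⟩ <;> rcases normalForm t with rfl | ⟨y', x', rfl⟩
    · rfl
    · rw [rep_zero, rep_normal] at h
      exact absurd h.symm (prefixRel_nonempty y' x').ne_empty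
    · rw [rep_zero, rep_normal] at h
      exact absurd h (prefixRel_nonempty y x).ne_empty
    · rw [rep_normal, rep_normal] at h
      obtain ⟨rfl, rfl⟩ := prefixRel_injective h
      rfl
  map_mul := rep_mul
  map_zero := rep_zero
  isPartialInj s := by
    rcases normalForm s with rfl | ⟨y, x, rfl⟩
    · rw [rep_zero]
      exact ⟨fun _ _ _ h => absurd h (Set.notMem_empty _),
        fun _ _ _ h => absurd h (Set.notMem_empty _)⟩
    · rw [rep_normal]
      exact isPartialInj_prefixRel y x
  eq_zero_or s := (normalForm s).imp_right fun ⟨y, x, h⟩ => ⟨y, x, h ▸ rep_normal y x⟩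
  exists_eq y x := ⟨_, rep_normal y x⟩

end Polycyclic

/-! ### The representation of the distributive completion. -/

namespace IsPrefixRep

variable {n : ℕ} [Nontrivial (Fin n)] {S : Type*} [SemigroupWithZero S] [InverseSemigroup S]
  {φ : S → SetRel (AperiodicSeq n) (AperiodicSeq n)}

/-- A prefix representation factors through the quotient by `↔`. -/
def lenzRep (hφ : IsPrefixRep φ) (a : LenzQuotient S) :
    SetRel (AperiodicSeq n) (AperiodicSeq n) :=
  Quotient.lift (s := (lenzCon S).toSetoid) φ
    (fun _ _ h => congrArg φ (hφ.eq_of_lenzArrow h.1 h.2)) a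

theorem isPrefixRep_lenzRep (hφ : IsPrefixRep φ) : IsPrefixRep hφ.lenzRep where
  injective a b := by
    induction a using LenzQuotient.ind
    induction b using LenzQuotient.ind
    exact fun h => congrArg LenzQuotient.mk (hφ.injective h)
  map_mul := LenzQuotient.ind fun a => LenzQuotient.ind fun b => hφ.map_mul a b
  map_zero := hφ.map_zero
  isPartialInj := LenzQuotient.ind hφ.isPartialInj
  eq_zero_or := LenzQuotient.ind fun a =>
    (hφ.eq_zero_or a).imp_left fun h => congrArg LenzQuotient.mk h
  exists_eq y x := (hφ.exists_eq y x).elim fun s hs => ⟨LenzQuotient.mk s, hs⟩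

/-- An order ideal is usually infinite, so `subset_of_lenzArrow` is applied to a finite generating
set, which has the same union. -/
theorem finCompat_con_iff (hφ : IsPrefixRep φ) (A B : FinCompat S) :
    FinCompat.con S A B ↔ ⋃ a ∈ A.carrier, φ a = ⋃ b ∈ B.carrier, φ b := by
  have key : ∀ A B : FinCompat S, LenzArrow A.carrier B.carrier →
      ⋃ a ∈ A.carrier, φ a ⊆ ⋃ b ∈ B.carrier, φ b := by
    intro A B h
    obtain ⟨Y, hY, -, hBY⟩ := B.fg
    have h' : LenzArrow B.carrier Y := by
      intro b hb x hx hxb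
      rw [hBY] at hb
      obtain ⟨y, hy, hby⟩ := hb
      exact ⟨y, hy, x, hx, natLE_refl x, NatLE.trans hxb hby⟩
    rw [hBY, hφ.biUnion_lowerSet]
    exact Set.iUnion₂_subset fun a ha => hφ.subset_of_lenzArrow hY (h.trans h') ha
  constructor
  · exact fun h => Set.Subset.antisymm (key A B h.1) (key B A h.2)
  · exact fun h => ⟨hφ.lenzArrow_of_subset fun a ha =>
      (Set.subset_biUnion_of_mem (u := φ) ha).trans h.le, hφ.lenzArrow_of_subset fun a ha =>
      (Set.subset_biUnion_of_mem (u := φ) ha).trans h.ge⟩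

/-- The extension of a prefix representation to the distributive completion. -/
def completionRep (hφ : IsPrefixRep φ) (d : DistribCompletion S) :
    SetRel (AperiodicSeq n) (AperiodicSeq n) :=
  Quotient.lift (s := (FinCompat.con (LenzQuotient S)).toSetoid)
    (fun A : FinCompat (LenzQuotient S) => ⋃ a ∈ A.carrier, hφ.lenzRep a)
    (fun A B h => (hφ.isPrefixRep_lenzRep.finCompat_con_iff A B).1 h) d

theorem completionRep_mk (hφ : IsPrefixRep φ) (A : FinCompat (LenzQuotient S)) :
    hφ.completionRep (DistribCompletion.mk A) = ⋃ a ∈ A.carrier, hφ.lenzRep a := rfl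

theorem completionRep_principal (hφ : IsPrefixRep φ) (a : LenzQuotient S) :
    hφ.completionRep (DistribCompletion.mk (FinCompat.principal a)) = hφ.lenzRep a := by
  rw [completionRep_mk]
  exact (hφ.isPrefixRep_lenzRep.biUnion_lowerSet {a}).trans (Set.biUnion_singleton _ _)

theorem completionRep_of (hφ : IsPrefixRep φ) (s : S) :
    hφ.completionRep (DistribCompletion.of S s) = φ s :=
  hφ.completionRep_principal (LenzQuotient.mk s)

/-- The class of an order ideal is determined by its union; compatibility of the ideal makes the
union a partial injection, and finite generation makes it finite. -/
theorem isPrefixUnionRep_completionRep (hφ : IsPrefixRep φ) :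
    IsPrefixUnionRep hφ.completionRep where
  injective d d' := by
    induction d using DistribCompletion.ind with | h A
    induction d' using DistribCompletion.ind with | h B
    exact fun h => (Con.eq (FinCompat.con (LenzQuotient S))).2
      ((hφ.isPrefixRep_lenzRep.finCompat_con_iff A B).2 h)
  map_mul := DistribCompletion.ind fun A => DistribCompletion.ind fun B => by
    change ⋃ c ∈ setMul A.carrier B.carrier, hφ.lenzRep c =
      SetRel.comp (⋃ a ∈ A.carrier, hφ.lenzRep a) (⋃ b ∈ B.carrier, hφ.lenzRep b)
    ext ⟨q, p⟩
    simp only [Set.mem_iUnion, SetRel.mem_comp]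
    constructor
    · rintro ⟨_, ⟨a, ha, b, hb, rfl⟩, h⟩
      obtain ⟨m, h1, h2⟩ := hφ.isPrefixRep_lenzRep.mem_mul.1 h
      exact ⟨m, ⟨a, ha, h1⟩, ⟨b, hb, h2⟩⟩
    · rintro ⟨m, ⟨a, ha, h1⟩, ⟨b, hb, h2⟩⟩
      exact ⟨a * b, ⟨a, ha, b, hb, rfl⟩, hφ.isPrefixRep_lenzRep.mem_mul.2 ⟨m, h1, h2⟩⟩
  map_zero := (hφ.completionRep_principal 0).trans hφ.isPrefixRep_lenzRep.map_zero
  isPartialInj := DistribCompletion.ind fun A =>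
    hφ.isPrefixRep_lenzRep.compatibleSet_iff.1 A.compat
  isPrefixUnion := DistribCompletion.ind fun A => by
    obtain ⟨X, hX, -, hAX⟩ := A.fg
    rw [completionRep_mk, hAX, hφ.isPrefixRep_lenzRep.biUnion_lowerSet]
    exact .biUnion hX fun a _ => hφ.isPrefixRep_lenzRep.isPrefixUnion a
  exists_eq R hR hRi := by
    obtain ⟨F, hF, rfl⟩ := hφ.isPrefixRep_lenzRep.exists_finite_eq hR
    -- The generator `0` serves only to make the generating set nonempty when `R = ∅`.
    have hF' : ⋃ a ∈ lowerSet (insert 0 F), hφ.lenzRep a = ⋃ a ∈ F, hφ.lenzRep a := by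
      rw [hφ.isPrefixRep_lenzRep.biUnion_lowerSet, Set.biUnion_insert,
        hφ.isPrefixRep_lenzRep.map_zero, Set.empty_union]
    exact ⟨DistribCompletion.mk ⟨lowerSet (insert 0 F),
      ⟨insert 0 F, hF.insert 0, Set.insert_nonempty _ _, rfl⟩,
      hφ.isPrefixRep_lenzRep.compatibleSet_iff.2 (hF' ▸ hRi)⟩, hF'⟩

end IsPrefixRep

/-! ### Order structure, joins and congruences -/

theorem IsPrefixUnion.exists_prefixRel_subset {n : ℕ}
    {R : SetRel (AperiodicSeq n) (AperiodicSeq n)} (hR : IsPrefixUnion R)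
    {r : AperiodicSeq n × AperiodicSeq n} (hr : r ∈ R) :
    ∃ y x, r ∈ prefixRel y x ∧ prefixRel y x ⊆ R := by
  induction hR with
  | empty => exact absurd hr (Set.notMem_empty r)
  | basic y x => exact ⟨y, x, hr, le_rfl⟩
  | union _ _ h1 h2 =>
    rcases hr with hr | hr
    · obtain ⟨y, x, h, h'⟩ := h1 hr
      exact ⟨y, x, h, h'.trans Set.subset_union_left⟩
    · obtain ⟨y, x, h, h'⟩ := h2 hr
      exact ⟨y, x, h, h'.trans Set.subset_union_right⟩

/-! ### Meets, joins, Boolean structure and congruences, read off from the relations. -/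

namespace IsPrefixUnionRep

section

variable {n : ℕ} {D : Type*} [SemigroupWithZero D] [InverseSemigroup D]
  {Φ : D → SetRel (AperiodicSeq n) (AperiodicSeq n)}

theorem isInverseMeetSemigroup (hΦ : IsPrefixUnionRep Φ) : IsInverseMeetSemigroup D := by
  intro a b
  obtain ⟨m, hm⟩ := hΦ.exists_eq _ ((hΦ.isPrefixUnion a).inter (hΦ.isPrefixUnion b))
    ((hΦ.isPartialInj a).mono Set.inter_subset_left)
  exact ⟨m, hΦ.isMeetOf_of_eq hm⟩

theorem exists_eq_biUnion (hΦ : IsPrefixUnionRep Φ) {A : Set D} (hA : A.Finite)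
    (hAc : CompatibleSet A) : ∃ j, Φ j = ⋃ a ∈ A, Φ a :=
  hΦ.exists_eq _ (.biUnion hA fun a _ => hΦ.isPrefixUnion a) (hΦ.compatibleSet_iff.1 hAc)

/-- The union of a finite compatible set is represented, its representative is a join, and joins are
unique. -/
theorem eq_biUnion_of_isJoinOf (hΦ : IsPrefixUnionRep Φ) {A : Set D} (hA : A.Finite)
    (hAc : CompatibleSet A) {j : D} (hj : IsJoinOf j A) : Φ j = ⋃ a ∈ A, Φ a := by
  obtain ⟨j', hj'⟩ := hΦ.exists_eq_biUnion hA hAc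
  rw [hj.unique (hΦ.isJoinOf_of_eq hj'), hj']

theorem isDistributiveInverse (hΦ : IsPrefixUnionRep Φ) : IsDistributiveInverse D := by
  refine ⟨fun A hA _ hAc => ?_, fun A hA _ hAc j hj a => ⟨?_, ?_⟩⟩
  · exact (hΦ.exists_eq_biUnion hA hAc).imp fun j hj => hΦ.isJoinOf_of_eq hj
  · apply hΦ.isJoinOf_of_eq
    rw [hΦ.map_mul, hΦ.eq_biUnion_of_isJoinOf hA hAc hj, Set.biUnion_image]
    ext ⟨q, p⟩
    simp only [SetRel.mem_comp, Set.mem_iUnion, hΦ.mem_mul]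
    tauto
  · apply hΦ.isJoinOf_of_eq
    rw [hΦ.map_mul, hΦ.eq_biUnion_of_isJoinOf hA hAc hj, Set.biUnion_image]
    ext ⟨q, p⟩
    simp only [SetRel.mem_comp, Set.mem_iUnion, hΦ.mem_mul]
    tauto

theorem exists_idempotent_eq (hΦ : IsPrefixUnionRep Φ)
    {R : SetRel (AperiodicSeq n) (AperiodicSeq n)} (hR : IsPrefixUnion R) (hid : R ⊆ SetRel.id) :
    ∃ e : {e : D // IsIdempotentElem e}, Φ e.1 = R := by
  have h1 : ∀ q p, (q, p) ∈ R → q = p := fun q p h => hid h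
  obtain ⟨e, rfl⟩ := hΦ.exists_eq R hR
    ⟨fun q q' p h h' => (h1 _ _ h).trans (h1 _ _ h').symm,
      fun q p p' h h' => (h1 _ _ h).symm.trans (h1 _ _ h')⟩
  exact ⟨⟨e, hΦ.isIdempotentElem_iff.2 hid⟩, rfl⟩

/-- The idempotents are the finite unions inside the diagonal. They are stable under union,
intersection and difference, so the Boolean structure is pulled back from the power set. -/
theorem isBooleanInverse (hΦ : IsPrefixUnionRep Φ) : IsBooleanInverse D := by
  refine ⟨hΦ.isDistributiveInverse, ?_⟩
  have hid : ∀ e : {e : D // IsIdempotentElem e}, Φ e.1 ⊆ SetRel.id := fun e =>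
    hΦ.isIdempotentElem_iff.1 e.2
  choose sup hsup using fun e f : {e : D // IsIdempotentElem e} =>
    hΦ.exists_idempotent_eq ((hΦ.isPrefixUnion e.1).union (hΦ.isPrefixUnion f.1))
      (Set.union_subset (hid e) (hid f))
  choose inf hinf using fun e f : {e : D // IsIdempotentElem e} =>
    hΦ.exists_idempotent_eq ((hΦ.isPrefixUnion e.1).inter (hΦ.isPrefixUnion f.1))
      (Set.inter_subset_left.trans (hid e))
  choose dif hdif using fun e f : {e : D // IsIdempotentElem e} =>
    hΦ.exists_idempotent_eq ((hΦ.isPrefixUnion e.1).diff (hΦ.isPrefixUnion f.1))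
      (Set.sdiff_subset.trans (hid e))
  let _ : Max {e : D // IsIdempotentElem e} := ⟨sup⟩
  let _ : Min {e : D // IsIdempotentElem e} := ⟨inf⟩
  let _ : SDiff {e : D // IsIdempotentElem e} := ⟨dif⟩
  let _ : Bot {e : D // IsIdempotentElem e} := ⟨⟨0, mul_zero 0⟩⟩
  let _ : LE {e : D // IsIdempotentElem e} := ⟨fun e f => NatLE e.1 f.1⟩
  let _ : LT {e : D // IsIdempotentElem e} := ⟨fun e f => Φ e.1 ⊂ Φ f.1⟩
  exact ⟨Function.Injective.generalizedBooleanAlgebra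
    (fun e : {e : D // IsIdempotentElem e} => (Φ e.1 : Set (AperiodicSeq n × AperiodicSeq n)))
    (fun e f h => Subtype.ext (hΦ.injective h)) hΦ.natLE_iff.symm Iff.rfl
    hsup hinf hΦ.map_zero hdif, fun e f => Iff.rfl⟩

/-- Around a point of `a` not in `b` there is a small prefix replacement contained in `a` and
invisible to `b`. Undoing it on both sides gives `c * a * d = 1` and `c * b * d = 0`, so the
congruence identifies everything with `0`. -/
theorem isCongruenceFree [Nontrivial (Fin n)] (hΦ : IsPrefixUnionRep Φ) :
    IsCongruenceFree D := by
  -- Only a semigroup structure is assumed; `e` represents the identity relation and plays the role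
  -- of `1`.
  obtain ⟨e, he⟩ := hΦ.exists_eq _ (.basic [] []) (isPartialInj_prefixRel [] [])
  have he0 : e ≠ 0 := by
    rintro rfl
    exact (prefixRel_nonempty [] []).ne_empty (he.symm.trans hΦ.map_zero)
  rw [prefixRel_nil_nil] at he
  have hone : ∀ z, z * e = z := fun z => hΦ.injective (by rw [hΦ.map_mul, he, SetRel.comp_id])
  have key : ∀ (ρ : Con D) (a b : D), ρ a b → ¬ Φ a ⊆ Φ b → ρ = ⊤ := by
    intro ρ a b hab hsub
    obtain ⟨r, hra, hrb⟩ := Set.not_subset.1 hsub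
    obtain ⟨y, x, ⟨w, rfl⟩, hyx⟩ := (hΦ.isPrefixUnion a).exists_prefixRel_subset hra
    obtain ⟨N, hN⟩ := (hΦ.isPrefixUnion b).exists_separating hrb
    obtain ⟨u, w, rfl, rfl⟩ := exists_app N w
    -- `d` prepends `x ++ u` to the input and `c` strips `y ++ u` from the output; in between, `a`
    -- replaces the one by the other, while by `hN` no pair of `b` has these prefixes.
    obtain ⟨c, hc⟩ := hΦ.exists_eq _ (.basic [] (y ++ u)) (isPartialInj_prefixRel _ _)
    obtain ⟨d, hd⟩ := hΦ.exists_eq _ (.basic (x ++ u) []) (isPartialInj_prefixRel _ _)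
    have h1 : c * a * d = e := by
      apply hΦ.injective
      rw [he]
      ext ⟨q, p⟩
      simp only [hΦ.mem_mul, hc, hd]
      constructor
      · rintro ⟨m, ⟨k, ⟨w1, h1⟩, h2⟩, ⟨w2, h3⟩⟩
        simp only [Prod.mk.injEq, app_nil] at h1 h3
        have h4 : (app (y ++ u) p, m) ∈ Φ a := by
          rw [h3.1, ← h3.2]
          exact hyx (prefixRel_append_subset y x u ⟨p, rfl⟩)
        have h5 := (hΦ.isPartialInj a).1 _ _ _ h2 h4
        rw [h1.2] at h5
        exact h1.1.trans (app_injective _ h5)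
      · intro h
        obtain rfl : q = p := h
        exact ⟨app (x ++ u) q, ⟨app (y ++ u) q, ⟨q, rfl⟩,
          hyx (prefixRel_append_subset y x u ⟨q, rfl⟩)⟩, ⟨q, rfl⟩⟩
    have h2 : c * b * d = 0 := by
      apply hΦ.injective
      rw [hΦ.map_zero]
      refine Set.eq_empty_of_forall_notMem ?_
      rintro ⟨q, p⟩ h
      simp only [hΦ.mem_mul, hc, hd] at h
      obtain ⟨m, ⟨k, ⟨w1, h1⟩, h2⟩, ⟨w2, h3⟩⟩ := h
      simp only [Prod.mk.injEq, app_nil] at h1 h3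
      rw [h1.2, h3.1] at h2
      exact hN (y ++ u) (x ++ u) w w (by simp) (by simp) (app_append _ _ _).symm
        (app_append _ _ _).symm _ _ h2
    have h3 : ρ e 0 := by
      rw [← h1, ← h2]
      exact ρ.mul (ρ.mul (ρ.refl c) hab) (ρ.refl d)
    have h4 : ∀ z, ρ z 0 := fun z => by
      have := ρ.mul (ρ.refl z) h3
      rwa [hone, mul_zero] at this
    exact eq_top_iff.2 fun z z' _ => ρ.trans (h4 z) (ρ.symm (h4 z'))
  have hnt : (⊥ : Con D) ≠ ⊤ := by
    intro h
    have h' : (⊤ : Con D) e 0 := trivial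
    rw [← h] at h'
    exact he0 h'
  refine { exists_pair_ne := ⟨⊥, ⊤, hnt⟩, eq_bot_or_eq_top := fun ρ => ?_ }
  by_cases hρ : ∀ a b, ρ a b → a = b
  · exact Or.inl (eq_bot_iff.2 fun a b h => hρ a b h)
  · push Not at hρ
    obtain ⟨a, b, hab, hne⟩ := hρ
    right
    by_cases hsub : Φ a ⊆ Φ b
    · exact key ρ b a (ρ.symm hab) fun h => hne (hΦ.injective (hsub.antisymm h))
    · exact key ρ a b hab hsub

end

end IsPrefixUnionRep

/-! ### The universal property of the completion -/

namespace IsPrefixRep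

section

variable {n : ℕ} [Nontrivial (Fin n)] {S : Type*} [SemigroupWithZero S] [InverseSemigroup S]
  {φ : S → SetRel (AperiodicSeq n) (AperiodicSeq n)}
  {T : Type*} [SemigroupWithZero T] [InverseSemigroup T] {θ : S →ₙ* T}

/-- The meets of `f` with the members of `G` form a finite cover of `f`, so `θ f` is the join of
their images, and each of these is below some `θ g`. -/
theorem natLE_of_subset_biUnion (hφ : IsPrefixRep φ) (hθ : IsCoverToJoin θ) {f : S} {G : Set S}
    (hG : G.Finite) (hfG : φ f ⊆ ⋃ g ∈ G, φ g) {c : T} (hc : ∀ g ∈ G, NatLE (θ g) c) :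
    NatLE (θ f) c := by
  choose m hm using hφ.exists_inter f
  have hcover : IsFiniteCover f (m '' G) := by
    refine ⟨hG.image m, ?_, hφ.lenzArrow_of_subset ?_⟩
    · rintro _ ⟨g, -, rfl⟩
      rw [hφ.natLE_iff, hm]
      exact Set.inter_subset_left
    · rintro _ rfl r hr
      have := hfG hr
      simp only [Set.mem_iUnion] at this
      obtain ⟨g, hg, hrg⟩ := this
      exact Set.mem_biUnion (Set.mem_image_of_mem m hg) (hm g ▸ ⟨hr, hrg⟩)
  refine (hθ _ _ hcover).2 c ?_
  rintro _ ⟨_, ⟨g, hg, rfl⟩, rfl⟩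
  refine NatLE.trans (NatLE.map θ ?_) (hc g hg)
  rw [hφ.natLE_iff, hm]
  exact Set.inter_subset_right

/-- This is the value of the extension at `R`. Two finite decompositions of `R` have images with the
same upper bounds by `natLE_of_subset_biUnion`, so the join does not depend on the choice. -/
theorem exists_isJoinOf_image (hφ : IsPrefixRep φ) (hT : IsDistributiveInverse T)
    (hθ : IsCoverToJoin θ) {R : SetRel (AperiodicSeq n) (AperiodicSeq n)}
    (hR : IsPrefixUnion R) (hRi : IsPartialInj R) :
    ∃ t, ∀ F : Set S, F.Finite → R = ⋃ f ∈ F, φ f → IsJoinOf t (θ '' F) := by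
  obtain ⟨F, hF, rfl⟩ := hφ.exists_finite_eq hR
  have hF0 : ⋃ f ∈ insert 0 F, φ f = ⋃ f ∈ F, φ f := by
    rw [Set.biUnion_insert, hφ.map_zero, Set.empty_union]
  have hc : CompatibleSet (insert 0 F) := hφ.compatibleSet_iff.2 (hF0 ▸ hRi)
  obtain ⟨t, ht⟩ := hT.1 (θ '' insert 0 F) ((hF.insert 0).image θ)
    ((Set.insert_nonempty 0 F).image θ) (by
      rintro _ ⟨a, ha, rfl⟩ _ ⟨b, hb, rfl⟩
      exact (hc a ha b hb).map θ)
  refine ⟨t, fun G hG hFG => ⟨?_, fun c hc => ht.2 c ?_⟩⟩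
  · rintro _ ⟨g, hg, rfl⟩
    refine hφ.natLE_of_subset_biUnion hθ (hF.insert 0) ?_
      fun f hf => ht.1 _ (Set.mem_image_of_mem θ hf)
    rw [hF0, hFG]
    exact Set.subset_biUnion_of_mem (u := φ) hg
  · rintro _ ⟨f, hf, rfl⟩
    refine hφ.natLE_of_subset_biUnion hθ hG ?_ fun g hg => hc _ (Set.mem_image_of_mem θ hg)
    rw [← hFG, ← hF0]
    exact Set.subset_biUnion_of_mem (u := φ) hf

end

end IsPrefixRep

theorem IsJoinOf.mul {T : Type*} [SemigroupWithZero T] [InverseSemigroup T]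
    (hT : IsDistributiveInverse T) {A B : Set T} (hA : A.Finite) (hA0 : A.Nonempty)
    (hAc : CompatibleSet A) (hB : B.Finite) (hB0 : B.Nonempty) (hBc : CompatibleSet B) {j k : T}
    (hj : IsJoinOf j A) (hk : IsJoinOf k B) : IsJoinOf (j * k) (setMul A B) := by
  constructor
  · rintro _ ⟨a, ha, b, hb, rfl⟩
    exact NatLE.trans (NatLE.mul_left (hk.1 b hb) a) (NatLE.mul_right (hj.1 a ha) k)
  · intro c hc
    refine (hT.2 A hA hA0 hAc j hj k).2.2 c ?_
    rintro _ ⟨a, ha, rfl⟩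
    refine (hT.2 B hB hB0 hBc k hk a).1.2 c ?_
    rintro _ ⟨b, hb, rfl⟩
    exact hc _ ⟨a, ha, b, hb, rfl⟩

section Completion

universe u w

variable {n : ℕ} [Nontrivial (Fin n)] {S : Type u} {D : Type w} [SemigroupWithZero S]
  [InverseSemigroup S] [SemigroupWithZero D] [InverseSemigroup D]
  {φ : S → SetRel (AperiodicSeq n) (AperiodicSeq n)}
  {Φ : D → SetRel (AperiodicSeq n) (AperiodicSeq n)} {δ : S →ₙ* D}

/-- The freedom in choosing the decomposition does the work: products of pieces decompose a product,
and unions of families decompose a join. Uniqueness holds since each `d` is the join of a finite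
compatible set of values of `δ`. -/
theorem IsPrefixRep.existsUnique_extension (hφ : IsPrefixRep φ) (hΦ : IsPrefixUnionRep Φ)
    (hδ : ∀ s, Φ (δ s) = φ s) {T : Type v} [SemigroupWithZero T] [InverseSemigroup T]
    (hT : IsDistributiveInverse T) (θ : S →ₙ* T) (hθ : IsCoverToJoin θ) :
    ∃! θ' : D →ₙ* T, IsJoinPreserving θ' ∧ θ'.comp δ = θ := by
  choose ψ hψ using fun d => hφ.exists_isJoinOf_image hT hθ (hΦ.isPrefixUnion d)
    (hΦ.isPartialInj d)
  have hcompat : ∀ (d : D) (F : Set S), Φ d = ⋃ f ∈ F, φ f → CompatibleSet F := fun d F h =>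
    hφ.compatibleSet_iff.2 (h ▸ hΦ.isPartialInj d)
  have hcompat' : ∀ (d : D) (F : Set S), Φ d = ⋃ f ∈ F, φ f → CompatibleSet (θ '' F) := by
    rintro d F h _ ⟨a, ha, rfl⟩ _ ⟨b, hb, rfl⟩
    exact (hcompat d F h a ha b hb).map θ
  have hmul : ∀ d d', ψ (d * d') = ψ d * ψ d' := by
    intro d d'
    obtain ⟨F, hF, hF0, hdF⟩ := hφ.exists_finite_nonempty_eq (hΦ.isPrefixUnion d)
    obtain ⟨G, hG, hG0, hdG⟩ := hφ.exists_finite_nonempty_eq (hΦ.isPrefixUnion d')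
    have h1 := IsJoinOf.mul hT (hF.image θ) (hF0.image θ) (hcompat' d F hdF) (hG.image θ)
      (hG0.image θ) (hcompat' d' G hdG) (hψ d F hF hdF) (hψ d' G hG hdG)
    have h2 : setMul (θ '' F) (θ '' G) = θ '' setMul F G := by
      ext t
      constructor
      · rintro ⟨_, ⟨a, ha, rfl⟩, _, ⟨b, hb, rfl⟩, rfl⟩
        exact ⟨a * b, ⟨a, ha, b, hb, rfl⟩, map_mul θ a b⟩
      · rintro ⟨_, ⟨a, ha, b, hb, rfl⟩, rfl⟩
        exact ⟨θ a, ⟨a, ha, rfl⟩, θ b, ⟨b, hb, rfl⟩, map_mul θ a b⟩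
    rw [h2] at h1
    refine (hψ (d * d') (setMul F G) ?_ ?_).unique h1
    · refine (Set.Finite.image2 (fun a b => a * b) hF hG).subset ?_
      rintro _ ⟨a, ha, b, hb, rfl⟩
      exact ⟨a, ha, b, hb, rfl⟩
    · rw [hΦ.map_mul, hdF, hdG]
      ext ⟨q, p⟩
      simp only [Set.mem_iUnion, SetRel.mem_comp]
      constructor
      · rintro ⟨m, ⟨a, ha, h1⟩, ⟨b, hb, h2⟩⟩
        exact ⟨a * b, ⟨a, ha, b, hb, rfl⟩, hφ.mem_mul.2 ⟨m, h1, h2⟩⟩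
      · rintro ⟨_, ⟨a, ha, b, hb, rfl⟩, h⟩
        obtain ⟨m, h1, h2⟩ := hφ.mem_mul.1 h
        exact ⟨m, ⟨a, ha, h1⟩, ⟨b, hb, h2⟩⟩
  refine ⟨⟨ψ, hmul⟩, ⟨?_, ?_⟩, ?_⟩
  · intro A j hA hAc hj
    -- Empty families must be allowed here, since join preservation includes the empty join.
    choose F hF hdF using fun d => hφ.exists_finite_eq (hΦ.isPrefixUnion d)
    have h1 := hψ j (⋃ d ∈ A, F d) (hA.biUnion fun d _ => hF d) (by
      rw [hΦ.eq_biUnion_of_isJoinOf hA hAc hj]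
      ext r
      simp only [Set.mem_iUnion]
      constructor
      · rintro ⟨d, hd, hr⟩
        rw [hdF d] at hr
        simp only [Set.mem_iUnion] at hr
        obtain ⟨f, hf, hr⟩ := hr
        exact ⟨f, ⟨d, hd, hf⟩, hr⟩
      · rintro ⟨f, ⟨d, hd, hf⟩, hr⟩
        exact ⟨d, hd, hdF d ▸ Set.mem_biUnion hf hr⟩)
    constructor
    · rintro _ ⟨d, hd, rfl⟩
      exact NatLE.map (⟨ψ, hmul⟩ : D →ₙ* T) (hj.1 d hd)
    · intro c hc
      refine h1.2 c ?_
      rintro _ ⟨f, hf, rfl⟩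
      simp only [Set.mem_iUnion] at hf
      obtain ⟨d, hd, hf⟩ := hf
      exact NatLE.trans ((hψ d (F d) (hF d) (hdF d)).1 _ ⟨f, hf, rfl⟩) (hc _ ⟨d, hd, rfl⟩)
  · ext s
    have h1 := hψ (δ s) {s} (Set.finite_singleton s) (by rw [hδ, Set.biUnion_singleton])
    rw [Set.image_singleton] at h1
    exact h1.unique ⟨by rintro _ rfl; exact natLE_refl _, fun c hc => hc _ rfl⟩
  · rintro θ' ⟨hθ', rfl⟩
    ext d
    obtain ⟨F, hF, hdF⟩ := hφ.exists_finite_eq (hΦ.isPrefixUnion d)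
    have h1 : Φ d = ⋃ a ∈ δ '' F, Φ a := by
      rw [Set.biUnion_image, hdF]
      simp only [hδ]
    have h2 := hθ' (δ '' F) d (hF.image δ)
      (hΦ.compatibleSet_iff.2 (h1 ▸ hΦ.isPartialInj d)) (hΦ.isJoinOf_of_eq h1)
    rw [← Set.image_comp] at h2
    exact h2.unique (hψ d F hF hdF)

theorem IsPrefixRep.isBooleanCompletion (hφ : IsPrefixRep φ) (hΦ : IsPrefixUnionRep Φ)
    (hδ : ∀ s, Φ (δ s) = φ s) : IsBooleanCompletion.{v} δ := by
  refine ⟨hΦ.isInverseMeetSemigroup, hΦ.isBooleanInverse, fun s hs => ?_, fun s A hA => ?_,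
    fun T _ _ hT θ hθ => hφ.existsUnique_extension hΦ hδ hT θ hθ⟩
  · apply hφ.injective
    rw [← hδ, hs, hΦ.map_zero, hφ.map_zero]
  · apply hΦ.isJoinOf_of_eq
    rw [Set.biUnion_image]
    simp only [hδ]
    refine Set.Subset.antisymm (hφ.subset_of_lenzArrow hA.1 hA.2.2 rfl) ?_
    exact Set.iUnion₂_subset fun a ha => hφ.natLE_iff.1 (hA.2.1 a ha)

end Completion

/-! ### The group of units -/

theorem IsPrefixUnion.inv {n : ℕ} {R : SetRel (AperiodicSeq n) (AperiodicSeq n)}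
    (hR : IsPrefixUnion R) : IsPrefixUnion R.inv := by
  induction hR with
  | empty => exact .empty
  | basic y x =>
    rw [inv_prefixRel]
    exact .basic x y
  | union _ _ h1 h2 => exact h1.union h2

/-- Once `x` is at least as long as the input words of all pieces, any piece containing a point with
input prefix `x` acts on the whole cylinder of `x` by a single prefix replacement. -/
theorem IsPrefixUnion.exists_length_bound {n : ℕ} {R : SetRel (AperiodicSeq n) (AperiodicSeq n)}
    (hR : IsPrefixUnion R) : ∃ N : ℕ, ∀ x : List (Fin n), N ≤ x.length →
      ∀ w q, (q, app x w) ∈ R → ∃ y, prefixRel y x ⊆ R := by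
  induction hR with
  | empty => exact ⟨0, fun _ _ _ _ h => absurd h (Set.notMem_empty _)⟩
  | basic y x =>
    refine ⟨x.length, ?_⟩
    rintro x' hx w q ⟨w', h⟩
    obtain ⟨t, rfl, -⟩ := prefix_of_length_le (congrArg Prod.snd h) hx
    exact ⟨y ++ t, prefixRel_append_subset y x t⟩
  | union _ _ h1 h2 =>
    obtain ⟨N₁, h1⟩ := h1
    obtain ⟨N₂, h2⟩ := h2
    refine ⟨max N₁ N₂, ?_⟩
    rintro x hx w q (h | h)
    · exact (h1 x (le_of_max_le_left hx) w q h).imp fun y h => h.trans Set.subset_union_left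
    · exact (h2 x (le_of_max_le_right hx) w q h).imp fun y h => h.trans Set.subset_union_right

/-! ### Essential isomorphisms acting on sequences. -/

namespace FreeAct

variable {n : ℕ}

theorem act_eq_of_snd {x x' : FreeAct n 1} {t : List (Fin n)} (h : x'.2 = x.2 ++ t) :
    x' = x.act t := Prod.ext (Subsingleton.elim _ _) h

/-- The action of a partial map of the free act on infinite sequences. -/
def boundaryRel (f : FreeAct n 1 ≃. FreeAct n 1) : SetRel (AperiodicSeq n) (AperiodicSeq n) :=
  {r | ∃ x y, y ∈ f x ∧ r ∈ prefixRel y.2 x.2}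

theorem boundaryRel_mono {f g : FreeAct n 1 ≃. FreeAct n 1} (h : f ≤ g) :
    boundaryRel f ⊆ boundaryRel g :=
  fun _ ⟨x, y, hy, hr⟩ => ⟨x, y, h x y hy, hr⟩

theorem boundaryRel_symm (f : FreeAct n 1 ≃. FreeAct n 1) :
    boundaryRel f.symm = (boundaryRel f).inv := by
  ext ⟨q, p⟩
  constructor
  · rintro ⟨x, y, hy, w, h⟩
    obtain ⟨rfl, rfl⟩ := Prod.mk.inj h
    exact ⟨y, x, f.mem_iff_mem.1 hy, w, rfl⟩
  · rintro ⟨x, y, hy, w, h⟩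
    obtain ⟨rfl, rfl⟩ := Prod.mk.inj h
    exact ⟨y, x, f.mem_iff_mem.2 hy, w, rfl⟩

theorem boundaryRel_refl : boundaryRel (PEquiv.refl (FreeAct n 1)) = SetRel.id := by
  ext ⟨q, p⟩
  constructor
  · rintro ⟨x, y, hy, w, h⟩
    obtain rfl : x = y := Option.some.inj hy
    obtain ⟨rfl, rfl⟩ := Prod.mk.inj h
    rfl
  · intro h
    obtain rfl : q = p := h
    exact ⟨(0, []), (0, []), rfl, q, rfl⟩

end FreeAct

namespace IsEssentialIso

open FreeAct

variable {n : ℕ} {f g : FreeAct n 1 ≃. FreeAct n 1}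

/-- Two words in the domain that begin the same sequence are comparable, and equivariance makes
their images differ by the same tail. -/
theorem boundaryRel_functional (hf : IsEssentialIso f) {q q' p : AperiodicSeq n}
    (h : (q, p) ∈ boundaryRel f) (h' : (q', p) ∈ boundaryRel f) : q = q' := by
  have key : ∀ {x y x' y' : FreeAct n 1} {w w' : AperiodicSeq n} {t : List (Fin n)},
      y ∈ f x → y' ∈ f x' → x'.2 = x.2 ++ t → w = app t w' → app y.2 w = app y'.2 w' := by
    rintro x y x' y' _ w' t hy hy' hx rfl
    rw [act_eq_of_snd hx] at hy'
    rw [Option.mem_unique hy' (hf.equivariant x y hy t), ← app_append]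
    rfl
  obtain ⟨x, y, hy, w, h⟩ := h
  obtain ⟨x', y', hy', w', h'⟩ := h'
  obtain ⟨rfl, rfl⟩ := Prod.mk.inj h
  obtain ⟨rfl, hxx'⟩ := Prod.mk.inj h'
  rcases app_compare hxx' with ⟨t, hx, hw⟩ | ⟨t, hx, hw⟩
  · exact key hy hy' hx hw
  · exact (key hy' hy hx hw).symm

theorem isPartialInj_boundaryRel (hf : IsEssentialIso f) : IsPartialInj (boundaryRel f) := by
  refine ⟨fun q q' p h h' => hf.boundaryRel_functional h h', fun q p p' h h' => ?_⟩
  have hs := boundaryRel_symm f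
  exact hf.symm.boundaryRel_functional (q := p) (q' := p') (p := q) (by rw [hs]; exact h)
    (by rw [hs]; exact h')

/-- By equivariance the piece over `z.act u` lies in the piece over `z`, so the generators of the
domain suffice. -/
theorem isPrefixUnion_boundaryRel (hf : IsEssentialIso f) : IsPrefixUnion (boundaryRel f) := by
  obtain ⟨F, hF, hFd⟩ := hf.dom_finGen
  have key : boundaryRel f = ⋃ x ∈ F, ⋃ y ∈ {y | y ∈ f x}, prefixRel y.2 x.2 := by
    ext r
    simp only [Set.mem_iUnion]
    constructor
    · rintro ⟨x, y, hy, hr⟩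
      have hx : x ∈ pequivDom f := mem_dom.2 ⟨y, hy⟩
      rw [hFd] at hx
      obtain ⟨z, hz, u, rfl⟩ := hx
      have hzd : z ∈ pequivDom f := by
        rw [hFd]
        exact ⟨z, hz, [], (act_nil z).symm⟩
      obtain ⟨z', hz'⟩ := mem_dom.1 hzd
      obtain rfl := Option.mem_unique hy (hf.equivariant z z' hz' u)
      exact ⟨z, hz, z', hz', prefixRel_append_subset _ _ _ hr⟩
    · rintro ⟨x, -, y, hy, hr⟩
      exact ⟨x, y, hy, hr⟩
  rw [key]
  refine .biUnion hF fun x _ => .biUnion ?_ fun y _ => .basic _ _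
  exact Set.Subsingleton.finite fun y hy y' hy' => Option.mem_unique hy hy'

/-- Essentiality becomes totality. If `N` bounds the generators in length, the prefix `u` of length
`N` extends to a word in the domain; the generator beginning that word is no longer than `u`, hence
already a prefix of `u`. -/
theorem exists_mem_boundaryRel (hf : IsEssentialIso f) (p : AperiodicSeq n) :
    ∃ q, (q, p) ∈ boundaryRel f := by
  obtain ⟨F, hF, hFd⟩ := hf.dom_finGen
  obtain ⟨N, hN⟩ : ∃ N, ∀ x ∈ F, x.2.length ≤ N := by
    obtain ⟨N, hN⟩ := (hF.image fun x => x.2.length).bddAbove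
    exact ⟨N, fun x hx => hN (Set.mem_image_of_mem _ hx)⟩
  obtain ⟨u, w, rfl, rfl⟩ := exists_app N p
  obtain ⟨v, hv⟩ := hf.exists_act (0, u)
  rw [hFd] at hv
  obtain ⟨z, hz, t, hzt⟩ := hv
  have hzd : z ∈ pequivDom f := by
    rw [hFd]
    exact ⟨z, hz, [], (act_nil z).symm⟩
  obtain ⟨z', hz'⟩ := mem_dom.1 hzd
  obtain ⟨s, rfl⟩ : z.2 <+: u :=
    List.prefix_of_prefix_length_le ⟨t, (congrArg Prod.snd hzt).symm⟩ ⟨v, rfl⟩ (hN z hz)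
  exact ⟨app z'.2 (app s w), z, z', hz', app s w, by rw [app_append]⟩

/-- The intermediate words of `f` and of `g` may have different lengths; equivariance lengthens the
shorter one until they match. -/
theorem boundaryRel_trans (hf : IsEssentialIso f) (hg : IsEssentialIso g) :
    boundaryRel (f.trans g) = (boundaryRel g).comp (boundaryRel f) := by
  ext ⟨q, p⟩
  constructor
  · rintro ⟨x, z, hz, w, h⟩
    obtain ⟨rfl, rfl⟩ := Prod.mk.inj h
    obtain ⟨y, hy, hz⟩ := (PEquiv.mem_trans f g x z).1 hz
    exact ⟨app y.2 w, ⟨y, z, hz, w, rfl⟩, ⟨x, y, hy, w, rfl⟩⟩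
  · rintro ⟨_, ⟨y, z, hz, w, h⟩, ⟨x, y', hy', w', h'⟩⟩
    obtain ⟨rfl, rfl⟩ := Prod.mk.inj h
    obtain ⟨hyy', rfl⟩ := Prod.mk.inj h'
    rcases app_compare hyy' with ⟨t, hy, rfl⟩ | ⟨t, hy, rfl⟩
    · rw [act_eq_of_snd hy] at hy'
      exact ⟨x, z.act t, (PEquiv.mem_trans f g _ _).2 ⟨_, hy', hg.equivariant y z hz t⟩, w',
        by rw [← app_append]; rfl⟩
    · rw [act_eq_of_snd hy] at hz
      exact ⟨x.act t, z, (PEquiv.mem_trans f g _ _).2 ⟨_, hf.equivariant x y' hy' t, hz⟩, w,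
        by rw [← app_append]; rfl⟩

/-- A total relation contained in a functional one equals it. -/
theorem boundaryRel_eq_of_le (hf : IsEssentialIso f) (hg : IsEssentialIso g) (h : f ≤ g) :
    boundaryRel f = boundaryRel g := by
  refine (boundaryRel_mono h).antisymm ?_
  rintro ⟨q, p⟩ hqp
  obtain ⟨q', h'⟩ := hf.exists_mem_boundaryRel p
  rwa [hg.boundaryRel_functional hqp (boundaryRel_mono h h')]

theorem eq_of_boundaryRel_eq [Nontrivial (Fin n)] (hf : IsEssentialIso f)
    (h : boundaryRel f = boundaryRel g) {x y y' : FreeAct n 1} (hy : y ∈ f x) (hy' : y' ∈ g x) :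
    y = y' := by
  obtain ⟨w⟩ := AperiodicSeq.nonempty (n := n)
  refine Prod.ext (Subsingleton.elim _ _) (app_free (w := w) ?_)
  refine hf.boundaryRel_functional ⟨x, y, hy, w, rfl⟩ ?_
  rw [h]
  exact ⟨x, y', hy', w, rfl⟩

end IsEssentialIso

/-! ### From relations on sequences back to the free act. -/

namespace FreeAct

variable {n : ℕ} {R : SetRel (AperiodicSeq n) (AperiodicSeq n)}

/-- The words the prefix of which is replaced uniformly by `R`. -/
def wordDom (R : SetRel (AperiodicSeq n) (AperiodicSeq n)) : Set (FreeAct n 1) :=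
  {x | ∃ y : FreeAct n 1, prefixRel y.2 x.2 ⊆ R}

theorem act_mem_wordDom {x : FreeAct n 1} (hx : x ∈ wordDom R) (u : List (Fin n)) :
    x.act u ∈ wordDom R :=
  hx.imp' (fun y => y.act u) fun _ h => (prefixRel_append_subset _ _ _).trans h

theorem exists_length_mem_wordDom [Nontrivial (Fin n)] (hR : IsPrefixUnion R)
    (ht : ∀ p, ∃ q, (q, p) ∈ R) : ∃ N, ∀ x : FreeAct n 1, N ≤ x.2.length → x ∈ wordDom R := by
  obtain ⟨N, hN⟩ := hR.exists_length_bound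
  obtain ⟨w⟩ := AperiodicSeq.nonempty (n := n)
  refine ⟨N, fun x hx => ?_⟩
  obtain ⟨q, hq⟩ := ht (app x.2 w)
  exact (hN x.2 hx w q hq).imp' (fun y => (0, y)) fun _ h => h

theorem isFinGen_wordDom [Nontrivial (Fin n)] (hR : IsPrefixUnion R)
    (ht : ∀ p, ∃ q, (q, p) ∈ R) : IsFinGen (wordDom R) := by
  obtain ⟨N, hN⟩ := exists_length_mem_wordDom hR ht
  refine ⟨{x | x ∈ wordDom R ∧ x.2.length ≤ N}, ?_, ?_⟩
  · refine ((List.finite_length_le (Fin n) N).image fun u => ((0, u) : FreeAct n 1)).subset ?_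
    rintro x ⟨-, hx⟩
    exact ⟨x.2, hx, Prod.ext (Subsingleton.elim _ _) rfl⟩
  · ext x
    constructor
    · intro hx
      rcases le_total x.2.length N with h | h
      · exact ⟨x, ⟨hx, h⟩, [], (act_nil x).symm⟩
      -- A longer word is generated by its truncation to length `N`, which lies in the domain
      -- because every word of length `N` does.
      · refine ⟨(0, x.2.take N), ⟨hN _ (by simp [h]), by simp⟩, x.2.drop N, act_eq_of_snd ?_⟩
        exact (List.take_append_drop N x.2).symm
    · rintro ⟨y, ⟨hy, -⟩, u, rfl⟩
      exact act_mem_wordDom hy u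

theorem isEssential_wordDom [Nontrivial (Fin n)] (hR : IsPrefixUnion R)
    (ht : ∀ p, ∃ q, (q, p) ∈ R) : IsEssential (wordDom R) := by
  obtain ⟨N, hN⟩ := exists_length_mem_wordDom hR ht
  obtain ⟨w⟩ := AperiodicSeq.nonempty (n := n)
  -- Any word of length `N` would do: acting by it makes every element long enough.
  obtain ⟨u, -, hu, -⟩ := exists_app N w
  rintro Z hZ ⟨z, hz⟩
  exact ⟨z.act u, hN _ (by simp [act, hu]), hZ z hz u⟩

open Classical in
/-- The partial map of the free act induced by a partial injection on sequences. -/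
noncomputable def wordPEquiv [Nontrivial (Fin n)] (hRi : IsPartialInj R) :
    FreeAct n 1 ≃. FreeAct n 1 where
  toFun x := if h : ∃ y : FreeAct n 1, prefixRel y.2 x.2 ⊆ R then some h.choose else none
  invFun y := if h : ∃ x : FreeAct n 1, prefixRel y.2 x.2 ⊆ R then some h.choose else none
  inv x y := by
    obtain ⟨w⟩ := AperiodicSeq.nonempty (n := n)
    -- Freeness at one sequence `w` makes the chosen word unique, in both directions.
    have h1 : ∀ {x y y' : FreeAct n 1}, prefixRel y.2 x.2 ⊆ R → prefixRel y'.2 x.2 ⊆ R →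
        y = y' := fun h h' => Prod.ext (Subsingleton.elim _ _)
      (app_free (hRi.1 _ _ _ (h ⟨w, rfl⟩) (h' ⟨w, rfl⟩)))
    have h2 : ∀ {x x' y : FreeAct n 1}, prefixRel y.2 x.2 ⊆ R → prefixRel y.2 x'.2 ⊆ R →
        x = x' := fun h h' => Prod.ext (Subsingleton.elim _ _)
      (app_free (hRi.2 _ _ _ (h ⟨w, rfl⟩) (h' ⟨w, rfl⟩)))
    constructor
    · intro h
      split_ifs at h with hex
      · obtain rfl := Option.some.inj h
        have hex' : ∃ y' : FreeAct n 1, prefixRel y'.2 hex.choose.2 ⊆ R := ⟨y, hex.choose_spec⟩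
        rw [dif_pos hex']
        exact congrArg some (h1 hex'.choose_spec hex.choose_spec)
    · intro h
      split_ifs at h with hex
      · obtain rfl := Option.some.inj h
        have hex' : ∃ x' : FreeAct n 1, prefixRel hex.choose.2 x'.2 ⊆ R := ⟨x, hex.choose_spec⟩
        rw [dif_pos hex']
        exact congrArg some (h2 hex'.choose_spec hex.choose_spec)

theorem mem_wordPEquiv [Nontrivial (Fin n)] (hRi : IsPartialInj R) {x y : FreeAct n 1} :
    y ∈ wordPEquiv hRi x ↔ prefixRel y.2 x.2 ⊆ R := by
  classical
  obtain ⟨w⟩ := AperiodicSeq.nonempty (n := n)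
  change y ∈ (if h : ∃ y : FreeAct n 1, prefixRel y.2 x.2 ⊆ R then some h.choose else none) ↔ _
  constructor
  · intro h
    split_ifs at h with hex
    · obtain rfl := Option.some.inj h
      exact hex.choose_spec
    · simp at h
  · intro h
    have hex : ∃ y : FreeAct n 1, prefixRel y.2 x.2 ⊆ R := ⟨y, h⟩
    rw [dif_pos hex]
    exact congrArg some (Prod.ext (Subsingleton.elim _ _)
      (app_free (hRi.1 _ _ _ (hex.choose_spec ⟨w, rfl⟩) (h ⟨w, rfl⟩))))

theorem pequivDom_wordPEquiv [Nontrivial (Fin n)] (hRi : IsPartialInj R) :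
    pequivDom (wordPEquiv hRi) = wordDom R := by
  ext x
  exact IsEssentialIso.mem_dom.trans (exists_congr fun y => mem_wordPEquiv hRi)

theorem pequivDom_wordPEquiv_symm [Nontrivial (Fin n)] (hRi : IsPartialInj R) :
    pequivDom (wordPEquiv hRi).symm = wordDom R.inv := by
  ext y
  refine IsEssentialIso.mem_dom.trans (exists_congr fun x => ?_)
  rw [PEquiv.mem_iff_mem, mem_wordPEquiv, ← inv_prefixRel y.2 x.2]
  exact ⟨fun h _ hr => h hr, fun h r hr => @h (r.2, r.1) hr⟩

theorem isEssentialIso_wordPEquiv [Nontrivial (Fin n)] (hR : IsPrefixUnion R)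
    (hRi : IsPartialInj R) (hd : ∀ p, ∃ q, (q, p) ∈ R) (hr : ∀ q, ∃ p, (q, p) ∈ R) :
    IsEssentialIso (wordPEquiv hRi) where
  equivariant _ _ hy _ := (mem_wordPEquiv hRi).2
    ((prefixRel_append_subset _ _ _).trans ((mem_wordPEquiv hRi).1 hy))
  dom_finGen := pequivDom_wordPEquiv hRi ▸ isFinGen_wordDom hR hd
  dom_essential := pequivDom_wordPEquiv hRi ▸ isEssential_wordDom hR hd
  ran_finGen := pequivDom_wordPEquiv_symm hRi ▸ isFinGen_wordDom hR.inv hr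
  ran_essential := pequivDom_wordPEquiv_symm hRi ▸ isEssential_wordDom hR.inv hr

theorem boundaryRel_wordPEquiv [Nontrivial (Fin n)] (hR : IsPrefixUnion R)
    (hRi : IsPartialInj R) : boundaryRel (wordPEquiv hRi) = R := by
  apply Set.Subset.antisymm
  · rintro r ⟨x, y, hy, hr⟩
    exact (mem_wordPEquiv hRi).1 hy hr
  · intro r hr
    obtain ⟨y, x, h, h'⟩ := hR.exists_prefixRel_subset hr
    exact ⟨(0, x), (0, y), (mem_wordPEquiv hRi).2 h', h⟩

end FreeAct

/-- Restriction does not change the induced relation. Conversely `f * (g.inv * g)` is `f` restricted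
to the domain of `g`; as a product it is again an essential isomorphism, and by freeness it agrees
with `g`. -/
theorem EssentialIso.sigma_iff {n : ℕ} [Nontrivial (Fin n)] {f g : EssentialIso n 1} :
    EssentialIso.sigma n 1 f g ↔ FreeAct.boundaryRel f.1 = FreeAct.boundaryRel g.1 := by
  constructor
  · rintro ⟨h, h1, h2⟩
    rw [← h.2.boundaryRel_eq_of_le f.2 h1, h.2.boundaryRel_eq_of_le g.2 h2]
  · intro h
    have key : ∀ x z, z ∈ (f * (g.inv * g)).1 x → z ∈ f.1 x ∧ z ∈ g.1 x := by
      intro x z hz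
      obtain ⟨y, hy, hz⟩ := (PEquiv.mem_trans _ _ x z).1 hz
      obtain ⟨w, hw, hy⟩ := (PEquiv.mem_trans _ _ x y).1 hy
      obtain rfl : x = y := g.1.inj hw (g.1.mem_iff_mem.1 hy)
      obtain rfl := f.2.eq_of_boundaryRel_eq h hz hw
      exact ⟨hz, hw⟩
    exact ⟨f * (g.inv * g), fun x z hz => (key x z hz).1, fun x z hz => (key x z hz).2⟩

/-- The homomorphism `f ↦ boundaryRel f` has kernel congruence exactly `sigma`, so it embeds the
group `G_{n,1}`, necessarily into the units. A unit is a bijection of the sequences, hence comes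
from `wordPEquiv`. -/
theorem IsPrefixUnionRep.nonempty_units_mulEquiv {n : ℕ} [Nontrivial (Fin n)] {D : Type*}
    [MonoidWithZero D] [InverseSemigroup D]
    {Φ : D → SetRel (AperiodicSeq n) (AperiodicSeq n)} (hΦ : IsPrefixUnionRep Φ) :
    Nonempty (Dˣ ≃* HigmanThompson n 1) := by
  obtain ⟨e, he⟩ := hΦ.exists_eq _ (.basic [] []) (isPartialInj_prefixRel [] [])
  rw [prefixRel_nil_nil] at he
  -- A representation is not assumed to preserve `1`; the element representing the identity relation
  -- is neutral, hence equal to `1`.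
  have h1 : Φ 1 = SetRel.id := by
    have : 1 * e = 1 := hΦ.injective (by rw [hΦ.map_mul, he, SetRel.comp_id])
    rw [← this, one_mul, he]
  choose ψ hψ using fun f : EssentialIso n 1 =>
    hΦ.exists_eq _ f.2.isPrefixUnion_boundaryRel f.2.isPartialInj_boundaryRel
  let θ : EssentialIso n 1 →* D :=
    { toFun := ψ
      map_one' := hΦ.injective (by rw [hψ, h1]; exact FreeAct.boundaryRel_refl)
      map_mul' := fun f g => hΦ.injective (by
        rw [hψ, hΦ.map_mul, hψ, hψ]
        exact g.2.boundaryRel_trans f.2) }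
  have hker : ∀ f g, ψ f = ψ g ↔ EssentialIso.sigma n 1 f g := fun f g => by
    rw [EssentialIso.sigma_iff, ← hψ, ← hψ, hΦ.injective.eq_iff]
  let η : HigmanThompson n 1 →* D :=
    (EssentialIso.sigma n 1).lift θ fun f g h => (hker f g).2 h
  refine ⟨(MulEquiv.ofBijective η.toHomUnits ⟨?_, ?_⟩).symm⟩
  · intro a b hab
    have hab' : η a = η b := congrArg Units.val hab
    induction a using Quotient.inductionOn with | h f
    induction b using Quotient.inductionOn with | h g
    exact Quotient.sound ((hker f g).1 hab')
  · intro u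
    -- The factorization of the identity as `u⁻¹ * u` sends every `p` through an intermediate point,
    -- which is an output of `u`.
    have hd : ∀ p, ∃ q, (q, p) ∈ Φ u := fun p => by
      have : (p, p) ∈ Φ (((u⁻¹ : Dˣ) : D) * u) := by
        rw [Units.inv_mul, h1]
        rfl
      obtain ⟨m, -, h⟩ := hΦ.mem_mul.1 this
      exact ⟨m, h⟩
    have hr : ∀ q, ∃ p, (q, p) ∈ Φ u := fun q => by
      have : (q, q) ∈ Φ (u * ((u⁻¹ : Dˣ) : D)) := by
        rw [Units.mul_inv, h1]
        rfl
      obtain ⟨m, h, -⟩ := hΦ.mem_mul.1 this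
      exact ⟨m, h⟩
    have hR := hΦ.isPrefixUnion (u : D)
    have hRi := hΦ.isPartialInj (u : D)
    let f : EssentialIso n 1 :=
      ⟨FreeAct.wordPEquiv hRi, FreeAct.isEssentialIso_wordPEquiv hR hRi hd hr⟩
    refine ⟨((f : EssentialIso n 1) : (EssentialIso.sigma n 1).Quotient), Units.ext ?_⟩
    apply hΦ.injective
    exact (hψ f).trans (FreeAct.boundaryRel_wordPEquiv hR hRi)

theorem theorem4p2 (n : ℕ) (hn : 2 ≤ n) :
    IsPreBoolean (Polycyclic n) ∧
    IsBooleanCompletion.{v} (DistribCompletion.of (Polycyclic n) :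
      Polycyclic n →ₙ* CuntzInverseMonoid n) ∧
    IsCongruenceFree (CuntzInverseMonoid n) ∧
    Nonempty ((CuntzInverseMonoid n)ˣ ≃* HigmanThompson n 1) := by
  have : Nontrivial (Fin n) := Fin.nontrivial_iff_two_le.2 hn
  have hφ := Polycyclic.isPrefixRep (n := n)
  have hΦ := hφ.isPrefixUnionRep_completionRep
  exact ⟨⟨hφ.isInverseMeetSemigroup, hΦ.isBooleanInverse⟩,
    hφ.isBooleanCompletion hΦ hφ.completionRep_of, hΦ.isCongruenceFree,
    hΦ.nonempty_units_mulEquiv⟩
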